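/- Graphs are finite and may have multiple edges. For a graph $G$, $d_G(v)$ is the degree of a vertex $v$; for $A\subseteq V(G)$, $d_G(A)$ is the number of edges with exactly one end in $A$ and $e_G(A)$ the number of edges with both ends in $A$. For an integer $m\ge 0$, $G$ is $m$-edge-connected if $d_G(A)\ge m$ for every $\emptyset\ne A\subsetneq V(G)$, and essentially $m$-edge-connected if $d_G(A)\ge m$ for every $A\subseteq V(G)$ with $2\le |A|\le |V(G)|-2$. Let $k$ be a positive integer. For $a\in\mathbb Z_k$, $[a]_k$ denotes the unique integer in $\{-1,0,\dots,k-2\}$ that is congruent to $a$ modulo $k$. A mapping $f:V(G)\to\mathbb Z_k$ is compatible with $G$ if for every partition $V(G)=X\sqcup Y$ into two (possibly empty) sets, either $\sum_{v\in X}f(v)-2x\equiv\sum_{v\in Y}f(v)\pmod k$ for some integer $0\le x\le e_G(X)$, or $\sum_{v\in X}f(v)\equiv\sum_{v\in Y}f(v)-2y\pmod k$ for some integer $0\le y\le e_G(Y)$. A factor of $G$ is a spanning subgraph. Theorem. Let $G$ be a bipartite graph, let $k$ be a positive integer, and let $f:V(G)\to\mathbb Z_k$ be compatible with $G$. Assume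 that (a) $G$ is essentially $(3k-3)$-edge-connected and $d_G(v)\ge 2k-1+[f(v)]_k$ for every vertex $v$, or (b) $G$ is $(3k-3)$-edge-connected. Then $G$ has a factor $H$ such that for every vertex $v$, $$d_H(v)\equiv f(v)\pmod k\quad\text{and}\quad \Big\lfloor\frac{d_G(v)}2\Big\rfloor-(k-1)\le d_H(v)\le\Big\lceil\frac{d_G(v)}2\Big\rceil+(k-1).$$ Furthermore, for every vertex $z$ and every integer $t$ with $t\equiv f(z)\pmod k$ and $\lfloor d_G(z)/2\rfloor-(k-1)\le t\le\lceil d_G(z)/2\rceil+(k-1)$, such a factor $H$ can be chosen with $d_H(z)=t$. -/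

import Mathlib

namespace ModFactor

variable {α β : Type*}

/-- The degree `d_G(v)` of a vertex; a loop counts twice. -/
noncomputable def degree (G : Graph α β) (v : α) : ℕ :=
  (G.incidenceSet v).ncard + (G.loopSet v).ncard

/-- The edge cut of a vertex set `A`: the edges with exactly one end in `A`. -/
def cutEdges (G : Graph α β) (A : Set α) : Set β :=
  {e | ∃ x y, G.IsLink e x y ∧ x ∈ A ∧ y ∉ A}

/-- `d_G(A)`, the number of edges with exactly one end in `A`. -/
noncomputable def cutSize (G : Graph α β) (A : Set α) : ℕ :=
  (cutEdges G A).ncard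

/-- `e_G(A)`, the number of edges with both ends in `A`. -/
noncomputable def innerSize (G : Graph α β) (A : Set α) : ℕ :=
  {e | ∃ x y, G.IsLink e x y ∧ x ∈ A ∧ y ∈ A}.ncard

/-- `X, Y` is a bipartition of the vertex set of `G` (edges inside the parts are allowed, and a
part may be empty). -/
def IsVertexBipartition (G : Graph α β) (X Y : Set α) : Prop :=
  Disjoint X Y ∧ X ∪ Y = G.vertexSet

/-- `G` is bipartite: for some bipartition of the vertex set, every edge joins the two parts. -/
def IsBipartite (G : Graph α β) : Prop :=
  ∃ X Y : Set α, IsVertexBipartition G X Y ∧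
    ∀ e x y, G.IsLink e x y → (x ∈ X ∧ y ∈ Y) ∨ (x ∈ Y ∧ y ∈ X)

/-- `G` is `m`-edge-connected. -/
def IsEdgeConnected (G : Graph α β) (m : ℕ) : Prop :=
  ∀ A : Set α, A ⊆ G.vertexSet → A.Nonempty → A ≠ G.vertexSet → m ≤ cutSize G A

/-- `G` is essentially `m`-edge-connected: an edge cut with fewer than `m` edges only separates a
single vertex from the rest, that is, `d_G(A) ≥ m` for every vertex set `A` with
`2 ≤ |A| ≤ |V(G)| - 2`. -/
def IsEssentiallyEdgeConnected (G : Graph α β) (m : ℕ) : Prop :=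
  ∀ A : Set α, A ⊆ G.vertexSet → 2 ≤ A.ncard → 2 ≤ (G.vertexSet \ A).ncard → m ≤ cutSize G A

/-- `f` is compatible with `G` with respect to the bipartition `X, Y` of the vertex set. -/
def IsCompatibleWrt (G : Graph α β) {k : ℕ} (f : α → ZMod k) (X Y : Set α) : Prop :=
  (∃ x : ℕ, x ≤ innerSize G X ∧ (∑ᶠ v ∈ X, f v) - 2 * (x : ZMod k) = ∑ᶠ v ∈ Y, f v) ∨
  (∃ y : ℕ, y ≤ innerSize G Y ∧ (∑ᶠ v ∈ X, f v) = (∑ᶠ v ∈ Y, f v) - 2 * (y : ZMod k))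

/-- `f` is compatible with `G`: it is so with respect to every bipartition of the vertex set. -/
def IsCompatible (G : Graph α β) {k : ℕ} (f : α → ZMod k) : Prop :=
  ∀ X Y : Set α, IsVertexBipartition G X Y → IsCompatibleWrt G f X Y

/-- `[a]_k`, the representative of `a` in `{-1, 0, …, k - 2}`; see `bracket_spec`. -/
def bracket {k : ℕ} (a : ZMod k) : ℤ :=
  ((a + 1).val : ℤ) - 1

theorem bracket_spec {k : ℕ} (hk : 0 < k) (a : ZMod k) :
    ((bracket a : ℤ) : ZMod k) = a ∧ -1 ≤ bracket a ∧ bracket a ≤ (k : ℤ) - 2 := by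
  have : NeZero k := ⟨hk.ne'⟩
  have h := ZMod.val_lt (a + 1)
  refine ⟨by simp [bracket], ?_, ?_⟩ <;> unfold bracket <;> omega

/-- `t` lies between `⌊d_G(v)/2⌋ - (k - 1)` and `⌈d_G(v)/2⌉ + (k - 1)`; the ceiling of half an
integer `d` is the floor of `(d + 1)/2`. -/
def InInterval (G : Graph α β) (k : ℕ) (v : α) (t : ℤ) : Prop :=
  (degree G v : ℤ) / 2 - ((k : ℤ) - 1) ≤ t ∧ t ≤ ((degree G v : ℤ) + 1) / 2 + ((k : ℤ) - 1)

/-- `H` is an `f`-factor of `G` (a spanning subgraph with `d_H(v) ≡ f(v)` modulo `k` everywhere)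
all of whose degrees lie in the prescribed intervals. -/
def IsBoundedFactor (G : Graph α β) {k : ℕ} (f : α → ZMod k) (H : Graph α β) : Prop :=
  H ≤s G ∧ ∀ v ∈ G.vertexSet,
    (degree H v : ZMod k) = f v ∧ InInterval G k v (degree H v)

end ModFactor

/-! Let $X,Y$ be the bipartition. A factor $H$ corresponds to an orientation of $G$: the edges of
$H$ go from $X$ to $Y$, the others from $Y$ to $X$. Out-degree minus in-degree at $v$ is then
$\pm(2d_H(v)-d_G(v))$, with sign $+$ on $X$. So the congruence modulo $k$ becomes a prescribed
residue $\tau(v)$ modulo $2k$, and the degree interval becomes the condition that this difference is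
less than $2k$ in absolute value. Compatibility with respect to $X,Y$ says that $\tau$ sums to $0$
modulo $2k$. Writing $\|\cdot\|$ for `cnorm`, either connectivity hypothesis gives $d(A)\ge
2k-2+\|\tau(A)\|$ for all nonempty proper $A$ (`le_cut`).

Under this cut condition the orientation exists (`RootedInstance.solvable`). For the induction the
statement is strengthened: there is a root whose edges are already directed and whose degree is at
most $2k-2$ plus the norm of its residue. The induction is on the number of vertices and edges away
from the root, then on the degree of the root.

If some proper set $A$ with at least two vertices is tight, contract $A$ and solve; then take
everything outside $A$ as the new root and solve inside $A$ (`solvable_of_tight`). Otherwise parity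
gives all such sets a slack of at least $2$. If then some vertex has residue $0$ or degree above its
bound, a pair of edges at it is lifted, or it is merged into its only neighbour
(`solvable_of_loose`). If neither occurs, every degree equals its bound, which makes the condition
on absolute values automatic (`solvable_of_modEq`). Only residues matter now, so root arcs can be
deleted and edges directed so as to bring residues closer to $0$ (`solvable_of_critical`).

The degree at $z$ is prescribed by attaching root arcs to $z$ (`exists_orientation`). -/

namespace ModFactor

/-! ### The norm on residues modulo $2k$. -/

/-- The distance from `z` to the nearest multiple of `2 * k`. -/
def cnorm (k : ℕ) (z : ℤ) : ℤ :=
  |(z + k) % (2 * k) - k|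

theorem cnorm_congr {k : ℕ} {z w : ℤ} (h : (2 * k : ℤ) ∣ z - w) : cnorm k z = cnorm k w := by
  have : (z + k) % (2 * k : ℤ) = (w + k) % (2 * k : ℤ) := by
    apply Int.emod_eq_emod_iff_emod_sub_eq_zero.2
    apply Int.emod_eq_zero_of_dvd
    simpa using h
  simp only [cnorm, this]

theorem cnorm_eq_abs {k : ℕ} (hk : 0 < k) {r : ℤ} (h : |r| ≤ k) : cnorm k r = |r| := by
  rw [abs_le] at h
  rcases eq_or_lt_of_le h.2 with h1 | h1
  · have : (r + k) % (2 * k : ℤ) = 0 := by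
      rw [h1, ← two_mul]; exact Int.emod_self
    rw [cnorm, this, h1]; simp
  · have : (r + k) % (2 * k : ℤ) = r + k := Int.emod_eq_of_lt (by omega) (by omega)
    simp [cnorm, this]

theorem exists_cnorm_rep {k : ℕ} (hk : 0 < k) (z : ℤ) :
    ∃ r : ℤ, |r| ≤ k ∧ (2 * k : ℤ) ∣ z - r ∧ cnorm k z = |r| := by
  have h0 := Int.emod_nonneg (z + k) (show (2 * k : ℤ) ≠ 0 by omega)
  have h1 := Int.emod_lt_of_pos (z + k) (show (0 : ℤ) < 2 * k by omega)
  refine ⟨(z + k) % (2 * k) - k, by rw [abs_le]; omega, ?_, rfl⟩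
  refine ⟨(z + k) / (2 * k), ?_⟩
  have := Int.emod_add_mul_ediv (z + k) (2 * k)
  linarith

theorem cnorm_le {k : ℕ} (hk : 0 < k) (z : ℤ) : cnorm k z ≤ k := by
  obtain ⟨r, h, -, h'⟩ := exists_cnorm_rep hk z
  omega

theorem cnorm_nonneg {k : ℕ} (z : ℤ) : 0 ≤ cnorm k z := abs_nonneg _

theorem cnorm_le_abs {k : ℕ} (hk : 0 < k) (z : ℤ) : cnorm k z ≤ |z| := by
  rcases le_total |z| k with h | h
  · exact (cnorm_eq_abs hk h).le
  · exact (cnorm_le hk z).trans h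

theorem cnorm_neg {k : ℕ} (hk : 0 < k) (z : ℤ) : cnorm k (-z) = cnorm k z := by
  obtain ⟨r, h, h1, h2⟩ := exists_cnorm_rep hk z
  rw [h2, ← abs_neg, ← cnorm_eq_abs hk (r := -r) (by rwa [abs_neg])]
  apply cnorm_congr
  rw [show -z - -r = -(z - r) by ring]
  exact (dvd_neg).2 h1

theorem cnorm_add_le {k : ℕ} (hk : 0 < k) (z w : ℤ) :
    cnorm k (z + w) ≤ cnorm k z + cnorm k w := by
  obtain ⟨r, h, h1, h2⟩ := exists_cnorm_rep hk z
  obtain ⟨s, h', h1', h2'⟩ := exists_cnorm_rep hk w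
  rw [h2, h2', cnorm_congr (w := r + s) (by rw [add_sub_add_comm]; exact dvd_add h1 h1')]
  exact (cnorm_le_abs hk _).trans (abs_add_le _ _)

theorem cnorm_add_le_abs {k : ℕ} (hk : 0 < k) (z w : ℤ) :
    cnorm k (z + w) ≤ cnorm k z + |w| :=
  (cnorm_add_le hk z w).trans (by have := cnorm_le_abs hk w; omega)

theorem cnorm_parity {k : ℕ} (hk : 0 < k) (z : ℤ) : (2 : ℤ) ∣ cnorm k z - z := by
  obtain ⟨r, h, ⟨n, h1⟩, h2⟩ := exists_cnorm_rep hk z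
  have h3 : z = r + 2 * (k * n) := by linarith
  rw [h2, h3]
  generalize (k : ℤ) * n = m
  rcases abs_cases r with ⟨h, -⟩ | ⟨h, -⟩ <;> rw [h] <;> omega

theorem dvd_of_cnorm_eq_zero {k : ℕ} (hk : 0 < k) {z : ℤ} (h : cnorm k z = 0) :
    (2 * k : ℤ) ∣ z := by
  obtain ⟨r, -, h1, h2⟩ := exists_cnorm_rep hk z
  have : r = 0 := abs_eq_zero.1 (h2 ▸ h)
  simpa [this] using h1

theorem cnorm_eq_zero_of_dvd {k : ℕ} (hk : 0 < k) {z : ℤ} (h : (2 * k : ℤ) ∣ z) :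
    cnorm k z = 0 := by
  rw [cnorm_congr (w := 0) (by simpa using h), cnorm_eq_abs hk (by simp)]
  simp

theorem cnorm_shift {k : ℕ} {z r : ℤ} (h1 : (2 * k : ℤ) ∣ z - r) (s : ℤ) :
    cnorm k (z + s) = cnorm k (r + s) :=
  cnorm_congr (by simpa using h1)

/-- On `[k, 3 * k]` the nearest multiple of `2 * k` is `2 * k` itself. -/
theorem cnorm_of_between {k : ℕ} (hk : 0 < k) {z : ℤ} (h1 : (k : ℤ) ≤ z) (h2 : z ≤ 3 * k) :
    cnorm k z = |z - 2 * k| := by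
  rw [← cnorm_eq_abs hk (r := z - 2 * k) (by rw [abs_le]; omega)]
  exact cnorm_congr (by simp)

/-- An integer of absolute value at most `2 * k - 2` plus its distance from the multiples of
`2 * k` has absolute value less than `2 * k`. -/
theorem abs_lt_of_le_cnorm {k : ℕ} (hk : 0 < k) {x z : ℤ} (h : (2 * k : ℤ) ∣ x - z)
    (hx : |x| ≤ 2 * k - 2 + cnorm k z) : |x| < 2 * k := by
  rw [← cnorm_congr h] at hx
  by_contra! hc
  have h1 : cnorm k x ≤ |x| - 2 * k := by
    rcases abs_cases x with ⟨h', h''⟩ | ⟨h', h''⟩ <;> rw [h'] at hc ⊢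
    · rw [cnorm_congr (w := x - 2 * k) (by simp)]
      refine (cnorm_le_abs hk _).trans (by rw [abs_of_nonneg] <;> omega)
    · rw [cnorm_congr (w := x + 2 * k) (by simp)]
      refine (cnorm_le_abs hk _).trans (by rw [abs_of_nonpos] <;> omega)
  omega

/-- An integer of absolute value less than `2 * k` has absolute value at most `2 * k - 2` plus
its distance from the multiples of `2 * k`. -/
theorem abs_le_of_abs_lt {k : ℕ} (hk : 0 < k) {t : ℤ} (ht : |t| < 2 * k) :
    |t| ≤ 2 * k - 2 + cnorm k t := by
  rcases le_or_gt |t| k with h | h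
  · rw [cnorm_eq_abs hk h]; omega
  · rcases abs_cases t with ⟨h', h''⟩ | ⟨h', h''⟩ <;> rw [h'] at h ht ⊢
    · rw [cnorm_of_between hk (by omega) (by omega), abs_of_nonpos (by omega)]; omega
    · rw [← cnorm_neg hk, cnorm_of_between hk (by omega) (by omega), abs_of_nonpos (by omega)]
      omega

/-! ### Cuts and net flows of oriented multigraphs. -/

section Orientation

variable {α β : Type*} [DecidableEq α]

/-- The indicator function of a finite set of vertices, with integer values. -/
def ind (A : Finset α) (x : α) : ℤ :=
  if x ∈ A then 1 else 0

/-- The number of edges in `F` with exactly one end in `A`; the ends of `e` are `p e` and `q e`. -/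
def cut (F : Finset β) (p q : β → α) (A : Finset α) : ℤ :=
  ∑ e ∈ F, |ind A (p e) - ind A (q e)|

/-- The number of edges leaving `A` minus the number of edges entering `A`, where `e` is directed
from `p e` to `q e` if `σ e = 1` and from `q e` to `p e` if `σ e = -1`. -/
def flow (F : Finset β) (p q : β → α) (σ : β → ℤ) (A : Finset α) : ℤ :=
  ∑ e ∈ F, σ e * (ind A (p e) - ind A (q e))

/-- The ends of `e` are `u` and `v`. -/
def Joins (p q : β → α) (e : β) (u v : α) : Prop :=
  (p e = u ∧ q e = v) ∨ (p e = v ∧ q e = u)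

/-- A choice of a direction for every edge. -/
def IsOrientation (σ : β → ℤ) : Prop :=
  ∀ e, σ e = 1 ∨ σ e = -1

theorem ind_mem {A : Finset α} {x : α} (h : x ∈ A) : ind A x = 1 := if_pos h

theorem ind_notMem {A : Finset α} {x : α} (h : x ∉ A) : ind A x = 0 := if_neg h

theorem ind_cases (A : Finset α) (x : α) :
    (x ∈ A ∧ ind A x = 1) ∨ (x ∉ A ∧ ind A x = 0) := by
  by_cases h : x ∈ A
  · exact .inl ⟨h, ind_mem h⟩
  · exact .inr ⟨h, ind_notMem h⟩

theorem ind_eq_sum (A : Finset α) (x : α) : ind A x = ∑ v ∈ A, ind {v} x := by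
  simp [ind, Finset.sum_ite_eq]

theorem sum_mul_ind (A : Finset α) (x : α) (s : ℤ) :
    ∑ v ∈ A, s * ind {x} v = s * ind A x := by
  simp [ind]

theorem sum_add_mul_ind (A : Finset α) (g : α → ℤ) (x : α) (s : ℤ) :
    ∑ v ∈ A, (g v + s * ind {x} v) = ∑ v ∈ A, g v + s * ind A x := by
  rw [Finset.sum_add_distrib, sum_mul_ind]

variable {F : Finset β} {p q : β → α} {σ : β → ℤ}

theorem cut_nonneg (A : Finset α) : 0 ≤ cut F p q A :=
  Finset.sum_nonneg fun _ _ => abs_nonneg _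

theorem flow_eq_sum (A : Finset α) : flow F p q σ A = ∑ v ∈ A, flow F p q σ {v} := by
  simp only [flow]
  rw [Finset.sum_comm]
  refine Finset.sum_congr rfl fun e _ => ?_
  rw [← Finset.mul_sum, Finset.sum_sub_distrib, ← ind_eq_sum, ← ind_eq_sum]

theorem IsOrientation.abs_flow_le (hσ : IsOrientation σ) (A : Finset α) :
    |flow F p q σ A| ≤ cut F p q A := by
  refine (Finset.abs_sum_le_sum_abs _ _).trans (Finset.sum_le_sum fun e _ => ?_)
  rw [abs_mul]
  rcases hσ e with h | h <;> simp [h]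

theorem IsOrientation.two_dvd (hσ : IsOrientation σ) (A : Finset α) :
    (2 : ℤ) ∣ cut F p q A - flow F p q σ A := by
  rw [cut, flow, ← Finset.sum_sub_distrib]
  refine Finset.dvd_sum fun e _ => ?_
  rcases ind_cases A (p e) with ⟨-, h1⟩ | ⟨-, h1⟩ <;>
    rcases ind_cases A (q e) with ⟨-, h2⟩ | ⟨-, h2⟩ <;>
    rcases hσ e with h | h <;> simp [h, h1, h2]

theorem Joins.symm {e : β} {u v : α} (h : Joins p q e u v) : Joins p q e v u := Or.symm h

theorem Joins.abs_eq {e : β} {u v : α} (h : Joins p q e u v) (A : Finset α) :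
    |ind A (p e) - ind A (q e)| = |ind A u - ind A v| := by
  rcases h with ⟨rfl, rfl⟩ | ⟨rfl, rfl⟩
  · rfl
  · exact abs_sub_comm _ _

theorem exists_joins_of_cut_ne_zero {A : Finset α} (h : cut F p q A ≠ 0) :
    ∃ e ∈ F, ∃ u ∈ A, ∃ x, x ∉ A ∧ Joins p q e u x := by
  obtain ⟨e, he, h'⟩ := Finset.exists_ne_zero_of_sum_ne_zero h
  refine ⟨e, he, ?_⟩
  rcases ind_cases A (p e) with ⟨a1, h1⟩ | ⟨a1, h1⟩ <;>
    rcases ind_cases A (q e) with ⟨a2, h2⟩ | ⟨a2, h2⟩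
  · simp [h1, h2] at h'
  · exact ⟨_, a1, _, a2, .inl ⟨rfl, rfl⟩⟩
  · exact ⟨_, a2, _, a1, .inr ⟨rfl, rfl⟩⟩
  · simp [h1, h2] at h'

theorem cut_compl {W A : Finset α} (hF : ∀ e ∈ F, p e ∈ W ∧ q e ∈ W) :
    cut F p q (W \ A) = cut F p q A := by
  refine Finset.sum_congr rfl fun e he => ?_
  rw [abs_sub_comm]
  simp only [ind, Finset.mem_sdiff, hF e he, true_and]
  split_ifs <;> simp_all

section Image

variable {W : Finset α} {φ : α → α}

theorem ind_image {B : Finset α} {x : α} (hx : x ∈ W) :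
    ind B (φ x) = ind (W.filter fun u => φ u ∈ B) x := by
  simp [ind, hx]

theorem cut_image (hF : ∀ e ∈ F, p e ∈ W ∧ q e ∈ W) (B : Finset α) :
    cut F (φ ∘ p) (φ ∘ q) B = cut F p q (W.filter fun u => φ u ∈ B) := by
  refine Finset.sum_congr rfl fun e he => ?_
  simp only [Function.comp, ind_image (hF e he).1, ind_image (hF e he).2]

theorem flow_image (hF : ∀ e ∈ F, p e ∈ W ∧ q e ∈ W) (B : Finset α) :
    flow F (φ ∘ p) (φ ∘ q) σ B = flow F p q σ (W.filter fun u => φ u ∈ B) := by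
  refine Finset.sum_congr rfl fun e he => ?_
  simp only [Function.comp, ind_image (hF e he).1, ind_image (hF e he).2]

theorem sum_image_fiber (g : α → ℤ) (B : Finset α) :
    ∑ v ∈ B, ∑ u ∈ W.filter (fun u => φ u = v), g u = ∑ u ∈ W.filter (fun u => φ u ∈ B), g u := by
  rw [← Finset.sum_fiberwise_of_maps_to (s := W.filter fun u => φ u ∈ B) (t := B) (g := φ)
    (fun u hu => (Finset.mem_filter.1 hu).2)]
  refine Finset.sum_congr rfl fun v hv => Finset.sum_congr ?_ fun _ _ => rfl
  ext u
  simp only [Finset.mem_filter]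
  constructor
  · rintro ⟨h, rfl⟩; exact ⟨⟨h, hv⟩, rfl⟩
  · rintro ⟨⟨h, -⟩, rfl⟩; exact ⟨h, rfl⟩

end Image

variable [DecidableEq β]

theorem cut_erase {e : β} {u v : α} (he : e ∈ F) (h : Joins p q e u v) (A : Finset α) :
    cut F p q A = cut (F.erase e) p q A + |ind A u - ind A v| := by
  rw [cut, ← Finset.sum_erase_add _ _ he, h.abs_eq, cut]

/-- Directing one more edge. -/
theorem exists_orient_edge {e : β} {u v : α} (he : e ∈ F) (h : Joins p q e u v)
    (hσ : IsOrientation σ) :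
    ∃ σ', IsOrientation σ' ∧ (∀ f, f ≠ e → σ' f = σ f) ∧
      ∀ A, flow F p q σ' A = flow (F.erase e) p q σ A + (ind A u - ind A v) := by
  have key : ∀ s : ℤ, (s = 1 ∨ s = -1) → (∀ A : Finset α,
      s * (ind A (p e) - ind A (q e)) = ind A u - ind A v) →
      ∃ σ', IsOrientation σ' ∧ (∀ f, f ≠ e → σ' f = σ f) ∧
      ∀ A, flow F p q σ' A = flow (F.erase e) p q σ A + (ind A u - ind A v) := by
    intro s hs hA
    refine ⟨Function.update σ e s, fun f => ?_, fun f hf => Function.update_of_ne hf _ _,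
      fun A => ?_⟩
    · by_cases hf : f = e
      · subst hf; simpa using hs
      · simpa [hf] using hσ f
    · rw [flow, ← Finset.sum_erase_add _ _ he, Function.update_self, hA]
      congr 1
      refine Finset.sum_congr rfl fun f hf => ?_
      rw [Function.update_of_ne (Finset.ne_of_mem_erase hf)]
  rcases h with ⟨h1, h2⟩ | ⟨h1, h2⟩
  · exact key 1 (.inl rfl) fun A => by rw [h1, h2, one_mul]
  · exact key (-1) (.inr rfl) fun A => by rw [h1, h2]; ring

/-- The cuts after the edges `e` from `v` to `y` and `f` from `v` to `w` are replaced by one edge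
from `y` to `w`. -/
theorem cut_lift {e f : β} {v y w : α} (he : e ∈ F) (hf : f ∈ F) (hef : e ≠ f)
    (hey : Joins p q e v y) (hfw : Joins p q f v w) (A : Finset α) :
    cut (F.erase f) (Function.update p e y) (Function.update q e w) A =
      cut F p q A - |ind A v - ind A y| - |ind A v - ind A w| + |ind A y - ind A w| := by
  have he' : e ∈ F.erase f := Finset.mem_erase.2 ⟨hef, he⟩
  rw [cut_erase hf hfw, cut_erase he' hey,
    cut_erase he' (u := y) (v := w) (.inl ⟨by simp, by simp⟩)]
  have : cut ((F.erase f).erase e) (Function.update p e y) (Function.update q e w) A =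
      cut ((F.erase f).erase e) p q A := by
    refine Finset.sum_congr rfl fun g hg => ?_
    rw [Function.update_of_ne (Finset.ne_of_mem_erase hg),
      Function.update_of_ne (Finset.ne_of_mem_erase hg)]
  rw [this]; ring

/-- The path $y,v,w$ is directed the way the lifted edge between $y$ and $w$ is; its two edges
cancel at $v$, so no net flow changes. -/
theorem exists_orient_lift {e f : β} {v y w : α} (he : e ∈ F) (hf : f ∈ F) (hef : e ≠ f)
    (hey : Joins p q e v y) (hfw : Joins p q f v w) (hσ : IsOrientation σ) :
    ∃ σ', IsOrientation σ' ∧ ∀ A, flow F p q σ' A =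
      flow (F.erase f) (Function.update p e y) (Function.update q e w) σ A := by
  have he' : e ∈ F.erase f := Finset.mem_erase.2 ⟨hef, he⟩
  have h0 : ∀ A, flow (F.erase f) (Function.update p e y) (Function.update q e w) σ A =
      flow ((F.erase f).erase e) p q σ A + σ e * (ind A y - ind A w) := by
    intro A
    rw [flow, ← Finset.sum_erase_add _ _ he', Function.update_self, Function.update_self]
    congr 1
    refine Finset.sum_congr rfl fun g hg => ?_
    rw [Function.update_of_ne (Finset.ne_of_mem_erase hg),
      Function.update_of_ne (Finset.ne_of_mem_erase hg)]
  rcases hσ e with h | h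
  · obtain ⟨σ₁, h1, -, h1'⟩ := exists_orient_edge he' hey.symm hσ
    obtain ⟨σ₂, h2, -, h2'⟩ := exists_orient_edge hf hfw h1
    exact ⟨σ₂, h2, fun A => by rw [h2', h1', h0, h]; ring⟩
  · obtain ⟨σ₁, h1, -, h1'⟩ := exists_orient_edge he' hey hσ
    obtain ⟨σ₂, h2, -, h2'⟩ := exists_orient_edge hf hfw.symm h1
    exact ⟨σ₂, h2, fun A => by rw [h2', h1', h0, h]; ring⟩

theorem exists_sign_sum (S : Finset β) (s : ℤ) (hs : |s| ≤ S.card)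
    (h2 : (2 : ℤ) ∣ S.card - s) : ∃ ε : β → ℤ, IsOrientation ε ∧ ∑ e ∈ S, ε e = s := by
  induction S using Finset.induction_on generalizing s with
  | empty => exact ⟨fun _ => 1, fun _ => .inl rfl, by simp at hs ⊢; omega⟩
  | insert a S ha ih =>
    rw [Finset.card_insert_of_notMem ha] at hs h2
    push_cast at hs h2
    have key : ∀ r : ℤ, (r = 1 ∨ r = -1) → |s - r| ≤ S.card →
        ∃ ε : β → ℤ, IsOrientation ε ∧ ∑ e ∈ insert a S, ε e = s := by
      intro r hr hle
      obtain ⟨ε, h, h'⟩ := ih (s - r) hle (by omega)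
      refine ⟨Function.update ε a r, fun f => ?_, ?_⟩
      · by_cases hf : f = a
        · subst hf; simpa using hr
        · simpa [hf] using h f
      · rw [Finset.sum_insert ha, Function.update_self, Finset.sum_congr rfl fun g hg => ?_, h']
        · ring
        · exact Function.update_of_ne (ne_of_mem_of_not_mem hg ha) _ _
    rw [abs_le] at hs
    rcases le_or_gt s 0 with h | h
    · exact key (-1) (.inr rfl) (by rw [abs_le]; omega)
    · exact key 1 (.inl rfl) (by rw [abs_le]; omega)

/-- The edges crossing `A` can be redirected so that the flow out of `A` takes a given value. -/
theorem exists_flow_eq (A : Finset α) {s : ℤ} (hs : |s| ≤ cut F p q A)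
    (h2 : (2 : ℤ) ∣ cut F p q A - s) (hσ : IsOrientation σ) :
    ∃ σ', IsOrientation σ' ∧ flow F p q σ' A = s ∧
      ∀ e ∈ F, ind A (p e) = ind A (q e) → σ' e = σ e := by
  set S := F.filter fun e => ind A (p e) ≠ ind A (q e) with hS
  have hone : ∀ e, ind A (p e) ≠ ind A (q e) →
      ind A (p e) - ind A (q e) = 1 ∨ ind A (p e) - ind A (q e) = -1 := by
    intro e h
    rcases ind_cases A (p e) with ⟨-, h1⟩ | ⟨-, h1⟩ <;>
      rcases ind_cases A (q e) with ⟨-, h2⟩ | ⟨-, h2⟩ <;> simp_all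
  have hcard : cut F p q A = S.card := by
    rw [cut, Finset.card_eq_sum_ones, hS, Finset.sum_filter]
    push_cast
    refine Finset.sum_congr rfl fun e _ => ?_
    by_cases h : ind A (p e) = ind A (q e)
    · simp [h]
    · rcases hone e h with h' | h' <;> simp [h, h']
  rw [hcard] at hs h2
  obtain ⟨ε, hε, hsum⟩ := exists_sign_sum S s hs h2
  refine ⟨fun e => if ind A (p e) = ind A (q e) then σ e else
    ε e * (ind A (p e) - ind A (q e)), fun e => ?_, ?_, fun e _ h => by simp [h]⟩
  · by_cases h : ind A (p e) = ind A (q e)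
    · simpa [h] using hσ e
    · rcases hone e h with h' | h' <;> rcases hε e with h'' | h'' <;> simp [h, h', h'']
  · rw [← hsum, hS, Finset.sum_filter, flow]
    refine Finset.sum_congr rfl fun e _ => ?_
    by_cases h : ind A (p e) = ind A (q e)
    · simp [h]
    · rcases hone e h with h' | h' <;> simp [h, h']

end Orientation

theorem dvd_of_eq_neg {m x y : ℤ} (h : m ∣ x) (hxy : y = -x) : m ∣ y :=
  hxy ▸ (dvd_neg).2 h

/-! ### Rooted instances, contraction, and reduction along a tight set. -/

section Rooted

variable {α β : Type*} [DecidableEq α]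

/-- A graph on the vertex set `W` together with a root outside `W` all of whose edges are already
directed: `c v` is the number of edges between the root and `v`, and `δ v` is the number of those
directed to `v` minus the number of those directed to the root. The integer `τ v` prescribes the
out-degree minus the in-degree of `v` modulo `2 * k`. -/
structure RootedInstance (k : ℕ) (W : Finset α) (F : Finset β) (p q : β → α) (c δ τ : α → ℤ)
    (v₀ : α) : Prop where
  ends : ∀ e ∈ F, p e ∈ W ∧ q e ∈ W
  abs_le : ∀ v ∈ W, |δ v| ≤ c v
  two_dvd : ∀ v ∈ W, (2 : ℤ) ∣ c v - δ v
  parity : ∀ A ⊆ W, (2 : ℤ) ∣ cut F p q A + ∑ v ∈ A, c v - ∑ v ∈ A, τ v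
  total : (2 * k : ℤ) ∣ ∑ v ∈ W, τ v + ∑ v ∈ W, δ v
  -- The inequality is opposite to the one for vertex sets: the root must be small enough for its
  -- predirected edges to be harmless.
  root : ∑ v ∈ W, c v ≤ 2 * k - 2 + cnorm k (∑ v ∈ W, δ v)
  -- One vertex of residue $0$ is exempt, because lifting may lower its degree below the bound.
  bound : ∀ A ⊆ W, A.Nonempty → A ≠ W → (A = {v₀} ∧ cnorm k (τ v₀) = 0) ∨
    2 * k - 2 + cnorm k (∑ v ∈ A, τ v) ≤ cut F p q A + ∑ v ∈ A, c v

/-- The directions at the root extend to an orientation with the prescribed degrees, such that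
out-degree and in-degree differ by less than `2 * k` at every vertex. -/
def Solvable (k : ℕ) (W : Finset α) (F : Finset β) (p q : β → α) (δ τ : α → ℤ) : Prop :=
  ∃ σ, IsOrientation σ ∧ ∀ v ∈ W,
    (2 * k : ℤ) ∣ flow F p q σ {v} - δ v - τ v ∧ |flow F p q σ {v} - δ v| < 2 * k

/-- All instances with fewer than `n` vertices and edges, not counting those at the root, are
solvable. -/
def SolvableBelow (α β : Type*) [DecidableEq α] (k n : ℕ) : Prop :=
  ∀ (W : Finset α) (F : Finset β) (p q : β → α) (c δ τ : α → ℤ) (v₀ : α),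
    F.card + W.card < n → RootedInstance k W F p q c δ τ v₀ → Solvable k W F p q δ τ

/-- The sum of `g` over the fibre of `φ` over `v`. -/
def fiberSum (W : Finset α) (φ : α → α) (g : α → ℤ) (v : α) : ℤ :=
  ∑ u ∈ W.filter (fun u => φ u = v), g u

theorem sum_fiberSum (W : Finset α) (φ : α → α) (g : α → ℤ) (B : Finset α) :
    ∑ v ∈ B, fiberSum W φ g v = ∑ u ∈ W.filter (fun u => φ u ∈ B), g u :=
  sum_image_fiber g B

theorem filter_mem_image_self (W : Finset α) (φ : α → α) :
    W.filter (fun u => φ u ∈ W.image φ) = W :=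
  Finset.filter_true_of_mem fun _ hu => Finset.mem_image_of_mem _ hu

theorem filter_image_nonempty {W B : Finset α} {φ : α → α} (hB : B ⊆ W.image φ)
    (h : B.Nonempty) : (W.filter fun u => φ u ∈ B).Nonempty := by
  obtain ⟨b, hb⟩ := h
  obtain ⟨u, hu, rfl⟩ := Finset.mem_image.1 (hB hb)
  exact ⟨u, Finset.mem_filter.2 ⟨hu, hb⟩⟩

theorem filter_image_ne {W B : Finset α} {φ : α → α} (hB : B ⊆ W.image φ)
    (h : B ≠ W.image φ) : (W.filter fun u => φ u ∈ B) ≠ W := by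
  intro h'
  refine h (hB.antisymm fun b hb => ?_)
  obtain ⟨u, hu, rfl⟩ := Finset.mem_image.1 hb
  rw [← h'] at hu
  exact (Finset.mem_filter.1 hu).2

variable {k : ℕ} {W : Finset α} {F : Finset β} {p q : β → α} {c δ τ : α → ℤ} {v₀ : α}

/-- Reversing all edges. Together with `RootedInstance.neg` this lets statements about one sign of
the residues serve for both. -/
theorem Solvable.neg (h : Solvable k W F p q (fun v => -δ v) (fun v => -τ v)) :
    Solvable k W F p q δ τ := by
  obtain ⟨σ, hσ, h⟩ := h
  refine ⟨fun e => -σ e, fun e => by rcases hσ e with h | h <;> simp [h], fun v hv => ?_⟩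
  have h1 : flow F p q (fun e => -σ e) {v} = -flow F p q σ {v} := by
    simp [flow, Finset.sum_neg_distrib]
  refine ⟨dvd_of_eq_neg (h v hv).1 (by rw [h1]; ring), ?_⟩
  rw [h1, show -flow F p q σ {v} - δ v = -(flow F p q σ {v} - -δ v) by ring, abs_neg]
  exact (h v hv).2

namespace RootedInstance

theorem neg (hk : 0 < k) (h : RootedInstance k W F p q c δ τ v₀) :
    RootedInstance k W F p q c (fun v => -δ v) (fun v => -τ v) v₀ where
  ends := h.ends
  abs_le v hv := by rw [abs_neg]; exact h.abs_le v hv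
  two_dvd v hv := by have := h.two_dvd v hv; omega
  parity A hA := by
    have := h.parity A hA
    rw [Finset.sum_neg_distrib]; omega
  total := by
    rw [Finset.sum_neg_distrib, Finset.sum_neg_distrib, ← neg_add]
    exact (dvd_neg).2 h.total
  root := by rw [Finset.sum_neg_distrib, cnorm_neg hk]; exact h.root
  bound A hA h1 h2 := by
    rw [Finset.sum_neg_distrib, cnorm_neg hk, cnorm_neg hk]; exact h.bound A hA h1 h2

/-- Identifying vertices. -/
theorem image (h : RootedInstance k W F p q c δ τ v₀) (φ : α → α) :
    RootedInstance k (W.image φ) F (φ ∘ p) (φ ∘ q) (fiberSum W φ c) (fiberSum W φ δ)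
      (fiberSum W φ τ) (φ v₀) where
  ends e he :=
    ⟨Finset.mem_image_of_mem _ (h.ends e he).1, Finset.mem_image_of_mem _ (h.ends e he).2⟩
  abs_le v _ := (Finset.abs_sum_le_sum_abs _ _).trans
    (Finset.sum_le_sum fun u hu => h.abs_le u (Finset.mem_filter.1 hu).1)
  two_dvd v _ := by
    rw [fiberSum, fiberSum, ← Finset.sum_sub_distrib]
    exact Finset.dvd_sum fun u hu => h.two_dvd u (Finset.mem_filter.1 hu).1
  parity B _ := by
    rw [cut_image h.ends, sum_fiberSum, sum_fiberSum]
    exact h.parity _ (Finset.filter_subset _ _)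
  total := by
    rw [sum_fiberSum, sum_fiberSum, filter_mem_image_self]; exact h.total
  root := by
    rw [sum_fiberSum, sum_fiberSum, filter_mem_image_self]; exact h.root
  bound B hB hB1 hB2 := by
    rw [cut_image h.ends, sum_fiberSum, sum_fiberSum]
    rcases h.bound _ (Finset.filter_subset _ _) (filter_image_nonempty hB hB1)
      (filter_image_ne hB hB2) with ⟨h1, h2⟩ | h1
    · left
      have hB' : B = {φ v₀} := by
        refine Finset.Subset.antisymm (fun b hb => ?_) ?_
        · obtain ⟨u, hu, rfl⟩ := Finset.mem_image.1 (hB hb)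
          have : u ∈ W.filter fun u => φ u ∈ B := Finset.mem_filter.2 ⟨hu, hb⟩
          rw [h1, Finset.mem_singleton] at this
          simp [this]
        · have : v₀ ∈ W.filter fun u => φ u ∈ B := by simp [h1]
          simpa using (Finset.mem_filter.1 this).2
      refine ⟨hB', ?_⟩
      have : W.filter (fun u => φ u = φ v₀) = {v₀} := by
        rw [← h1, hB']; simp
      rw [fiberSum, this, Finset.sum_singleton, h2]
    · exact .inr h1

/-- The part of the graph inside `A`, with the rest as root. -/
theorem restrict [DecidableEq β] (h : RootedInstance k W F p q c δ τ v₀) {A : Finset α}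
    (hA : A ⊆ W) {σ : β → ℤ} (hσ : IsOrientation σ)
    (hflow : (2 * k : ℤ) ∣ flow F p q σ A - ∑ v ∈ A, δ v - ∑ v ∈ A, τ v)
    (htight : cut F p q A + ∑ v ∈ A, c v ≤ 2 * k - 2 + cnorm k (∑ v ∈ A, τ v)) (hk : 0 < k) :
    RootedInstance k A (F.filter fun e => p e ∈ A ∧ q e ∈ A) p q
      (fun v => c v + cut (F.filter fun e => ¬(p e ∈ A ∧ q e ∈ A)) p q {v})
      (fun v => δ v - flow (F.filter fun e => ¬(p e ∈ A ∧ q e ∈ A)) p q σ {v}) τ v₀ := by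
  set C := F.filter fun e => ¬(p e ∈ A ∧ q e ∈ A) with hC
  set I := F.filter fun e => p e ∈ A ∧ q e ∈ A with hI
  have hcut : ∀ B, cut F p q B = cut I p q B + cut C p q B := fun B =>
    (Finset.sum_filter_add_sum_filter_not F _ _).symm
  have hflow' : ∀ B, flow F p q σ B = flow I p q σ B + flow C p q σ B := fun B =>
    (Finset.sum_filter_add_sum_filter_not F _ _).symm
  -- An edge of $C$ has at most one end in $A$, so inside $A$ it behaves like an edge to the root.
  have hsum : ∀ B ⊆ A, cut C p q B = ∑ v ∈ B, cut C p q {v} := by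
    intro B hB
    simp only [cut]
    rw [Finset.sum_comm]
    refine Finset.sum_congr rfl fun e he => ?_
    rw [hC, Finset.mem_filter, not_and_or] at he
    rcases he.2 with h' | h'
    · have h0 : ∀ v ∈ B, |ind {v} (p e) - ind {v} (q e)| = ind {v} (q e) := by
        intro v hv
        have : p e ≠ v := fun h => h' (h ▸ hB hv)
        rcases ind_cases {v} (q e) with ⟨-, h2⟩ | ⟨-, h2⟩ <;> simp [ind_notMem, this, h2]
      rw [Finset.sum_congr rfl h0, ← ind_eq_sum, ind_notMem fun h => h' (hB h)]
      rcases ind_cases B (q e) with ⟨-, h2⟩ | ⟨-, h2⟩ <;> simp [h2]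
    · have h0 : ∀ v ∈ B, |ind {v} (p e) - ind {v} (q e)| = ind {v} (p e) := by
        intro v hv
        have : q e ≠ v := fun h => h' (h ▸ hB hv)
        rcases ind_cases {v} (p e) with ⟨-, h2⟩ | ⟨-, h2⟩ <;> simp [ind_notMem, this, h2]
      rw [Finset.sum_congr rfl h0, ← ind_eq_sum, ind_notMem fun h => h' (hB h)]
      rcases ind_cases B (p e) with ⟨-, h2⟩ | ⟨-, h2⟩ <;> simp [h2]
  have hdeg : ∀ B ⊆ A, cut I p q B + ∑ v ∈ B, (c v + cut C p q {v}) =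
      cut F p q B + ∑ v ∈ B, c v := by
    intro B hB
    rw [Finset.sum_add_distrib, ← hsum B hB, hcut]; ring
  have hIA : cut I p q A = 0 ∧ flow I p q σ A = 0 := by
    constructor
    all_goals
      refine Finset.sum_eq_zero fun e he => ?_
      rw [hI, Finset.mem_filter] at he
      simp [ind_mem, he.2.1, he.2.2]
  have hδ : ∑ v ∈ A, (δ v - flow C p q σ {v}) = ∑ v ∈ A, δ v - flow F p q σ A := by
    rw [Finset.sum_sub_distrib, ← flow_eq_sum, hflow', hIA.2, zero_add]
  have hδτ : (2 * k : ℤ) ∣ ∑ v ∈ A, τ v + ∑ v ∈ A, (δ v - flow C p q σ {v}) := by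
    exact dvd_of_eq_neg hflow (by rw [hδ]; ring)
  refine ⟨fun e he => (Finset.mem_filter.1 he).2, fun v hv => ?_, fun v hv => ?_,
    fun B hB => ?_, hδτ, ?_, fun B hB h1 h2 => ?_⟩
  · have h1 := h.abs_le v (hA hv)
    have h2 := hσ.abs_flow_le (F := C) (p := p) (q := q) {v}
    exact (abs_sub _ _).trans (add_le_add h1 h2)
  · have h1 := h.two_dvd v (hA hv)
    have h2 := hσ.two_dvd (F := C) (p := p) (q := q) {v}
    omega
  · rw [hdeg B hB]; exact h.parity B (hB.trans hA)
  -- The degree of the new root is the full degree of $A$, so tightness of $A$ is exactly the root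
  -- condition.
  · have h1 := hdeg A subset_rfl
    rw [hIA.1, zero_add] at h1
    rw [h1]
    refine htight.trans (le_of_eq ?_)
    rw [← cnorm_neg hk]
    congr 1
    exact cnorm_congr (dvd_of_eq_neg hδτ (by ring))
  · rw [hdeg B hB]
    refine h.bound B (hB.trans hA) h1 fun h3 => h2 ?_
    exact hB.antisymm (h3 ▸ hA)

/-- If the bound for `A` holds with equality, it suffices to solve the problem with `A`
identified to one vertex, and then the problem inside `A`. -/
theorem solvable_of_tight [DecidableEq β] (hk : 0 < k) (h : RootedInstance k W F p q c δ τ v₀)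
    (IH : SolvableBelow α β k (F.card + W.card))
    {A : Finset α} (hA : A ⊆ W) (hA2 : 2 ≤ A.card) (hAW : A ≠ W)
    (htight : cut F p q A + ∑ v ∈ A, c v ≤ 2 * k - 2 + cnorm k (∑ v ∈ A, τ v)) :
    Solvable k W F p q δ τ := by
  obtain ⟨a, ha⟩ : A.Nonempty := Finset.card_pos.1 (by omega)
  set φ : α → α := fun x => if x ∈ A then a else x with hφ
  have hφA : ∀ x ∈ A, φ x = a := fun x hx => by simp [hφ, hx]
  have hφn : ∀ x, x ∉ A → φ x = x := fun x hx => by simp [hφ, hx]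
  have hcard : (W.image φ).card < W.card := by
    apply lt_of_le_of_ne Finset.card_image_le
    intro hc
    rw [Finset.card_image_iff] at hc
    obtain ⟨x, hx, y, hy, hxy⟩ := Finset.one_lt_card.1 (by omega : 1 < A.card)
    exact hxy (hc (hA hx) (hA hy) (by rw [hφA x hx, hφA y hy]))
  -- Edges inside $A$ become loops, which count in neither cuts nor flows; the instance is smaller
  -- because it has fewer vertices.
  obtain ⟨σ₁, hσ₁, h1⟩ := IH _ _ _ _ _ _ _ _ (by omega) (h.image φ)
  have hfa : W.filter (fun u => φ u = a) = A := by
    ext u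
    simp only [Finset.mem_filter]
    constructor
    · rintro ⟨-, hu⟩
      by_contra hn
      rw [hφn u hn] at hu
      exact hn (hu ▸ ha)
    · exact fun hu => ⟨hA hu, hφA u hu⟩
  have hfv : ∀ v ∈ W, v ∉ A → W.filter (fun u => φ u = v) = {v} := by
    intro v hv hvA
    ext u
    simp only [Finset.mem_filter, Finset.mem_singleton]
    constructor
    · rintro ⟨-, hu⟩
      by_cases hn : u ∈ A
      · rw [hφA u hn] at hu; exact absurd (hu ▸ ha) hvA
      · rwa [hφn u hn] at hu
    · rintro rfl
      exact ⟨hv, hφn _ hvA⟩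
  have h1a := h1 a (Finset.mem_image.2 ⟨a, hA ha, hφA a ha⟩)
  simp only [flow_image h.ends, Finset.mem_singleton, fiberSum, hfa] at h1a
  have hAc : A.card < W.card := Finset.card_lt_card (hA.ssubset_of_ne hAW)
  have hFc : (F.filter fun e => p e ∈ A ∧ q e ∈ A).card ≤ F.card := Finset.card_filter_le _ _
  obtain ⟨σ₂, hσ₂, h2⟩ := IH _ _ _ _ _ _ _ _ (by omega) (h.restrict hA hσ₁ h1a.1 htight hk)
  refine ⟨fun e => if p e ∈ A ∧ q e ∈ A then σ₂ e else σ₁ e, fun e => ?_, fun v hv => ?_⟩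
  · by_cases he : p e ∈ A ∧ q e ∈ A
    · simpa [he] using hσ₂ e
    · simpa [he] using hσ₁ e
  by_cases hvA : v ∈ A
  · have h2v := h2 v hvA
    have : flow F p q (fun e => if p e ∈ A ∧ q e ∈ A then σ₂ e else σ₁ e) {v} =
        flow (F.filter fun e => p e ∈ A ∧ q e ∈ A) p q σ₂ {v} +
        flow (F.filter fun e => ¬(p e ∈ A ∧ q e ∈ A)) p q σ₁ {v} := by
      rw [flow, ← Finset.sum_filter_add_sum_filter_not F fun e => p e ∈ A ∧ q e ∈ A]
      congr 1
      · exact Finset.sum_congr rfl fun e he => by rw [if_pos (Finset.mem_filter.1 he).2]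
      · exact Finset.sum_congr rfl fun e he => by rw [if_neg (Finset.mem_filter.1 he).2]
    rwa [this, show ∀ x y z : ℤ, x + y - z = x - (z - y) from fun _ _ _ => by ring]
  · have h1v := h1 v (Finset.mem_image.2 ⟨v, hv, hφn v hvA⟩)
    simp only [flow_image h.ends, Finset.mem_singleton, fiberSum, hfv v hv hvA,
      Finset.sum_singleton] at h1v
    have : flow F p q (fun e => if p e ∈ A ∧ q e ∈ A then σ₂ e else σ₁ e) {v} =
        flow F p q σ₁ {v} := by
      refine Finset.sum_congr rfl fun e _ => ?_
      by_cases he : p e ∈ A ∧ q e ∈ A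
      · have h3 : p e ≠ v := fun h => hvA (h ▸ he.1)
        have h4 : q e ≠ v := fun h => hvA (h ▸ he.2)
        simp [ind, h3, h4]
      · simp [he]
    rw [this]
    exact h1v

end RootedInstance

end Rooted

/-! ### Lifting at a vertex of residue zero or of large degree. -/

section Loose

variable {α β : Type*}
variable {k : ℕ} {W : Finset α} {F : Finset β} {p q : β → α} {c δ τ : α → ℤ} {v v₀ : α}

theorem eq_singleton_or_two_le_card {A : Finset α} (h : A.Nonempty) :
    (∃ x, A = {x}) ∨ 2 ≤ A.card := by
  have := Finset.card_pos.2 h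
  rcases Nat.lt_or_ge A.card 2 with h' | h'
  · exact .inl (Finset.card_eq_one.1 (by omega))
  · exact .inr h'

theorem Joins.eq_of_joins {e : β} {v y w : α} (h1 : Joins p q e v y) (h2 : Joins p q e v w) :
    y = w := by
  rcases h1 with ⟨rfl, rfl⟩ | ⟨rfl, rfl⟩ <;> rcases h2 with ⟨h, h'⟩ | ⟨h, h'⟩ <;> simp_all

theorem Joins.mem {e : β} {u x : α} (h : Joins p q e u x) (hF : ∀ e ∈ F, p e ∈ W ∧ q e ∈ W)
    (he : e ∈ F) : u ∈ W ∧ x ∈ W := by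
  rcases h with ⟨rfl, rfl⟩ | ⟨rfl, rfl⟩
  · exact hF e he
  · exact (hF e he).symm

theorem ends_lift [DecidableEq β] {e f : β} {y w : α} (hF : ∀ e ∈ F, p e ∈ W ∧ q e ∈ W) (hy : y ∈ W)
    (hw : w ∈ W) : ∀ g ∈ F.erase f,
      Function.update p e y g ∈ W ∧ Function.update q e w g ∈ W := by
  intro g hg
  by_cases hge : g = e
  · subst hge; simp [hy, hw]
  · simpa [hge] using hF g (Finset.mem_of_mem_erase hg)

variable [DecidableEq α]

theorem ind_singleton_comm (u v : α) : ind {u} v = ind {v} u := by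
  simp [ind, eq_comm]

theorem RootedInstance.cnorm_sum_δ (hk : 0 < k) (h : RootedInstance k W F p q c δ τ v₀) :
    cnorm k (∑ v ∈ W, δ v) = cnorm k (∑ v ∈ W, τ v) := by
  rw [← cnorm_neg hk]
  exact cnorm_congr (dvd_of_eq_neg h.total (by ring))

/-- A vertex that may be lifted is adjacent to some other vertex than the root. -/
theorem RootedInstance.cut_ne_zero_of_loose (hk : 0 < k) (h : RootedInstance k W F p q c δ τ v)
    (hvW : v ∈ W) (hW : W ≠ {v})
    (hv : cnorm k (τ v) = 0 ∨ 2 * k + cnorm k (τ v) ≤ cut F p q {v} + c v) (hc : c v ≠ 0) :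
    cut F p q {v} ≠ 0 := by
  intro h0
  have hB : (W \ {v}).Nonempty := by
    rw [Finset.sdiff_nonempty]
    exact fun hs => hW (hs.antisymm (by simpa using hvW))
  -- Without edges from $v$ to the rest, the bound for $W\setminus\{v\}$ and the root condition
  -- leave at most $\|\tau(v)\|$ root edges for $v$, against either alternative of `hv`.
  have h1 := (h.bound (W \ {v}) Finset.sdiff_subset hB
    (fun h' => by
      have : v ∈ W \ {v} := h'.symm ▸ hvW
      simp at this)).resolve_left
      (fun h' => by
        have : v ∈ W \ {v} := by rw [h'.1]; simp
        simp at this)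
  rw [cut_compl h.ends, h0, zero_add] at h1
  have hsum : ∀ g : α → ℤ, ∑ u ∈ W, g u = ∑ u ∈ W \ {v}, g u + g v := fun g => by
    rw [← Finset.sum_sdiff (Finset.singleton_subset_iff.2 hvW), Finset.sum_singleton]
  have h2 := h.root
  rw [h.cnorm_sum_δ hk, hsum c, hsum τ] at h2
  have h3 := cnorm_add_le hk (∑ u ∈ W \ {v}, τ u) (τ v)
  have h4 := h.abs_le v hvW
  have h5 := abs_nonneg (δ v)
  omega

variable [DecidableEq β]

/-- The change of a cut under lifting. -/
theorem cut_lift_cases {e f : β} {v y w : α} (he : e ∈ F) (hf : f ∈ F) (hef : e ≠ f)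
    (hey : Joins p q e v y) (hfw : Joins p q f v w) (A : Finset α) :
    cut (F.erase f) (Function.update p e y) (Function.update q e w) A = cut F p q A ∨
    (cut (F.erase f) (Function.update p e y) (Function.update q e w) A = cut F p q A - 2 ∧
      ((v ∈ A ∧ y ∉ A ∧ w ∉ A) ∨ (v ∉ A ∧ y ∈ A ∧ w ∈ A))) := by
  have h := cut_lift he hf hef hey hfw A
  rcases ind_cases A v with ⟨a1, i1⟩ | ⟨a1, i1⟩ <;>
    rcases ind_cases A y with ⟨a2, i2⟩ | ⟨a2, i2⟩ <;>
    rcases ind_cases A w with ⟨a3, i3⟩ | ⟨a3, i3⟩ <;>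
    rw [i1, i2, i3] at h <;> norm_num at h <;> simp [a1, a2, a3] <;> omega

namespace RootedInstance

/-- Lifting two edges at `v`. -/
theorem solvable_of_lift (h : RootedInstance k W F p q c δ τ v)
    (IH : SolvableBelow α β k (F.card + W.card))
    (hS : ∀ A ⊆ W, 2 ≤ A.card → A ≠ W →
      2 * k + cnorm k (∑ v ∈ A, τ v) ≤ cut F p q A + ∑ v ∈ A, c v)
    (hv : cnorm k (τ v) = 0 ∨ 2 * k + cnorm k (τ v) ≤ cut F p q {v} + c v)
    {e f : β} {y w : α} (he : e ∈ F) (hf : f ∈ F) (hyw : y ≠ w)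
    (hey : Joins p q e v y) (hfw : Joins p q f v w) : Solvable k W F p q δ τ := by
  have hef : e ≠ f := fun hef => hyw (hey.eq_of_joins (hef ▸ hfw))
  have hcard := Finset.card_erase_lt_of_mem hf
  -- Lifting costs a set at most $2$: larger sets have that slack, $v$ has it or becomes the exempt
  -- vertex, and since $y\ne w$ no other single vertex loses anything.
  have hnew : RootedInstance k W (F.erase f) (Function.update p e y) (Function.update q e w) c δ τ
      v := by
    refine ⟨ends_lift h.ends (hey.mem h.ends he).2 (hfw.mem h.ends hf).2, h.abs_le, h.two_dvd,
      fun A hA => ?_, h.total, h.root, fun A hA h1 h2 => ?_⟩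
    · have := h.parity A hA
      rcases cut_lift_cases he hf hef hey hfw A with h' | ⟨h', -⟩ <;> rw [h'] <;> omega
    · rcases eq_singleton_or_two_le_card h1 with ⟨x, rfl⟩ | hc
      · by_cases hx : x = v
        · subst hx
          rcases hv with hv | hv
          · exact .inl ⟨rfl, hv⟩
          · right
            simp only [Finset.sum_singleton]
            rcases cut_lift_cases he hf hef hey hfw {x} with h' | ⟨h', -⟩ <;> rw [h'] <;> omega
        · rcases h.bound _ hA h1 h2 with h3 | h3
          · exact absurd (Finset.singleton_injective h3.1) hx
          · right
            rcases cut_lift_cases he hf hef hey hfw {x} with h' | ⟨-, h'⟩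
            · rwa [h']
            · simp only [Finset.mem_singleton] at h'
              rcases h' with ⟨h', -⟩ | ⟨-, h', h''⟩
              · exact absurd h'.symm hx
              · exact absurd (h'.trans h''.symm) hyw
      · right
        have := hS A hA hc h2
        rcases cut_lift_cases he hf hef hey hfw A with h' | ⟨h', -⟩ <;> rw [h'] <;> omega
  obtain ⟨σ, hσ, hs⟩ := IH _ _ _ _ _ _ _ _ (by omega) hnew
  obtain ⟨σ', hσ', hs'⟩ := exists_orient_lift he hf hef hey hfw hσ
  exact ⟨σ', hσ', fun u hu => by rw [hs']; exact hs u hu⟩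

/-- Lifting an edge between the root and `v` together with an edge between `v` and `w`. -/
theorem solvable_of_root_lift (h : RootedInstance k W F p q c δ τ v)
    (IH : SolvableBelow α β k (F.card + W.card))
    (hS : ∀ A ⊆ W, 2 ≤ A.card → A ≠ W →
      2 * k + cnorm k (∑ v ∈ A, τ v) ≤ cut F p q A + ∑ v ∈ A, c v)
    (hv : cnorm k (τ v) = 0 ∨ 2 * k + cnorm k (τ v) ≤ cut F p q {v} + c v)
    {f : β} {w : α} (hf : f ∈ F) (hvw : v ≠ w) (hfw : Joins p q f v w) (hc : c v ≠ 0) :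
    Solvable k W F p q δ τ := by
  have hcard := Finset.card_erase_lt_of_mem hf
  obtain ⟨hvW, hwW⟩ := hfw.mem h.ends hf
  -- The sign $s$ is the direction of an existing root arc at $v$, with $1$ meaning towards $v$.
  -- Lifting moves this arc to $w$, and the edge $vw$ will continue it.
  obtain ⟨s, hs, hsv⟩ : ∃ s : ℤ, (s = 1 ∨ s = -1) ∧ |δ v - s| ≤ c v - 1 := by
    have h1 := h.abs_le v hvW
    have h2 := h.two_dvd v hvW
    rw [_root_.abs_le] at h1
    by_cases h3 : δ v = - c v
    · exact ⟨-1, .inr rfl, by rw [_root_.abs_le]; omega⟩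
    · exact ⟨1, .inl rfl, by rw [_root_.abs_le]; omega⟩
  have hcut := cut_erase hf hfw
  have hsum : ∀ A, ∑ u ∈ A, (c u + (-1) * ind {v} u + 1 * ind {w} u) =
      ∑ u ∈ A, c u + (-1) * ind A v + 1 * ind A w := fun A => by
    rw [sum_add_mul_ind, sum_add_mul_ind]
  have hsumδ : ∑ u ∈ W, (δ u + (-s) * ind {v} u + s * ind {w} u) = ∑ u ∈ W, δ u := by
    rw [sum_add_mul_ind, sum_add_mul_ind, ind_mem hvW, ind_mem hwW]; ring
  have hnew : RootedInstance k W (F.erase f) p q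
      (fun u => c u + (-1) * ind {v} u + 1 * ind {w} u)
      (fun u => δ u + (-s) * ind {v} u + s * ind {w} u) τ v := by
    refine ⟨fun g hg => h.ends g (Finset.mem_of_mem_erase hg), fun u hu => ?_, fun u hu => ?_,
      fun A hA => ?_, by rw [hsumδ]; exact h.total, ?_, fun A hA h1 h2 => ?_⟩
    · have h1 := h.abs_le u hu
      by_cases huv : u = v
      · subst huv
        simp only [ind_mem (Finset.mem_singleton_self u), ind_notMem (by simpa using hvw : u ∉ {w})]
        rw [show δ u + -s * 1 + s * 0 = δ u - s by ring]
        omega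
      · rw [ind_notMem (by simpa using huv : u ∉ {v})]
        rcases ind_cases {w} u with ⟨-, i⟩ | ⟨-, i⟩ <;> rw [i] <;> rw [_root_.abs_le] at h1 ⊢ <;>
          rcases hs with rfl | rfl <;> omega
    · have := h.two_dvd u hu
      rcases hs with rfl | rfl <;> omega
    · have := h.parity A hA
      rw [hsum]
      rw [hcut] at this
      rcases ind_cases A v with ⟨-, i1⟩ | ⟨-, i1⟩ <;>
        rcases ind_cases A w with ⟨-, i2⟩ | ⟨-, i2⟩ <;>
        rw [i1, i2] at this ⊢ <;> norm_num at this ⊢ <;> omega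
    · rw [hsum, hsumδ, ind_mem hvW, ind_mem hwW]
      have := h.root
      omega
    · have hdrop : cut F p q A + ∑ u ∈ A, c u - 2 ≤
          cut (F.erase f) p q A + ∑ u ∈ A, (c u + (-1) * ind {v} u + 1 * ind {w} u) ∧
          (v ∉ A → cut F p q A + ∑ u ∈ A, c u =
          cut (F.erase f) p q A + ∑ u ∈ A, (c u + (-1) * ind {v} u + 1 * ind {w} u)) := by
        rw [hsum, hcut]
        rcases ind_cases A v with ⟨a, i1⟩ | ⟨a, i1⟩ <;>
          rcases ind_cases A w with ⟨-, i2⟩ | ⟨-, i2⟩ <;>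
          rw [i1, i2] <;> norm_num [a] <;> omega
      by_cases hx : A = {v}
      · rcases hv with hv | hv
        · exact .inl ⟨hx, hv⟩
        · right
          have h3 : cut F p q A + ∑ u ∈ A, c u = cut F p q {v} + c v := by
            rw [hx, Finset.sum_singleton]
          have h4 : ∑ u ∈ A, τ u = τ v := by rw [hx, Finset.sum_singleton]
          rw [h4]
          omega
      · right
        rcases eq_singleton_or_two_le_card h1 with ⟨x, rfl⟩ | hc
        · have hvx : v ∉ ({x} : Finset α) := fun hm => hx (by rw [Finset.mem_singleton.1 hm])
          rw [← hdrop.2 hvx]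
          exact (h.bound _ hA h1 h2).resolve_left fun h3 => hx h3.1
        · have := hS A hA hc h2
          omega
  obtain ⟨σ, hσ, hs'⟩ := IH _ _ _ _ _ _ _ _ (by omega) hnew
  have key : ∀ σ', (∀ A, flow F p q σ' A = flow (F.erase f) p q σ A +
      s * (ind A v - ind A w)) → ∀ u ∈ W, (2 * k : ℤ) ∣ flow F p q σ' {u} - δ u - τ u ∧
      |flow F p q σ' {u} - δ u| < 2 * k := by
    intro σ' h1 u hu
    have : flow F p q σ' {u} - δ u =
        flow (F.erase f) p q σ {u} - (δ u + (-s) * ind {v} u + s * ind {w} u) := by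
      rw [h1, ind_singleton_comm u v, ind_singleton_comm u w]
      ring
    rw [this]
    exact hs' u hu
  rcases hs with rfl | rfl
  · obtain ⟨σ', h1, -, h2⟩ := exists_orient_edge hf hfw hσ
    exact ⟨σ', h1, key σ' fun A => by rw [h2]; ring⟩
  · obtain ⟨σ', h1, -, h2⟩ := exists_orient_edge hf hfw.symm hσ
    exact ⟨σ', h1, key σ' fun A => by rw [h2]; ring⟩

/-- A vertex with only one neighbour. -/
theorem solvable_of_one_neighbor (hk : 0 < k) (h : RootedInstance k W F p q c δ τ v₀)
    (IH : SolvableBelow α β k (F.card + W.card)) {y : α} (hvW : v ∈ W) (hyW : y ∈ W)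
    (hyv : y ≠ v) (hc : c v = 0)
    (hcut : cnorm k (τ v) = 0 ∨ 2 * k + cnorm k (τ v) ≤ cut F p q {v})
    (hall : ∀ e ∈ F, ∀ w, w ≠ v → Joins p q e v w → w = y) : Solvable k W F p q δ τ := by
  set φ : α → α := fun x => if x = v then y else x with hφ
  have hφv : φ v = y := by simp [hφ]
  have hφn : ∀ x, x ≠ v → φ x = x := fun x hx => by simp [hφ, hx]
  have hcard : (W.image φ).card < W.card := by
    apply lt_of_le_of_ne Finset.card_image_le
    intro hc
    rw [Finset.card_image_iff] at hc
    exact hyv (hc hyW hvW (by rw [hφv, hφn y hyv]))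
  -- Solve with $v$ merged into $y$. Only edges between $v$ and $y$ are redirected afterwards, so
  -- the merged net flow $s$ merely has to be split as $r$ at $v$ and $s-r$ at $y$.
  obtain ⟨σ₁, hσ₁, h1⟩ := IH _ _ _ _ _ _ _ _ (by omega) (h.image φ)
  have hfy : W.filter (fun u => φ u = y) = {v, y} := by
    ext u
    simp only [Finset.mem_filter, Finset.mem_insert, Finset.mem_singleton]
    constructor
    · rintro ⟨-, hu⟩
      by_cases huv : u = v
      · exact .inl huv
      · right; rwa [hφn u huv] at hu
    · rintro (rfl | rfl)
      · exact ⟨hvW, hφv⟩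
      · exact ⟨hyW, hφn _ hyv⟩
  have hfu : ∀ u ∈ W, u ≠ v → u ≠ y → W.filter (fun x => φ x = u) = {u} := by
    intro u hu huv huy
    ext x
    simp only [Finset.mem_filter, Finset.mem_singleton]
    constructor
    · rintro ⟨-, hx⟩
      by_cases hxv : x = v
      · subst hxv; exact absurd (hφv ▸ hx).symm huy
      · rwa [hφn x hxv] at hx
    · rintro rfl
      exact ⟨hu, hφn _ huv⟩
  have h1y := h1 y (Finset.mem_image.2 ⟨y, hyW, hφn y hyv⟩)
  simp only [flow_image h.ends, Finset.mem_singleton, fiberSum, hfy] at h1y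
  have hpar := h.parity {v} (by simpa using hvW)
  simp only [Finset.sum_singleton, hc, add_zero] at hpar
  obtain ⟨r, hr, hr', hr2, hrs⟩ : ∃ r : ℤ, (2 * k : ℤ) ∣ r - τ v ∧ |r| ≤ cut F p q {v} ∧
      |r| < 2 * k ∧ |flow F p q σ₁ {v, y} - ∑ u ∈ {v, y}, δ u - r| < 2 * k := by
    have hs := h1y.2
    generalize flow F p q σ₁ {v, y} - ∑ u ∈ {v, y}, δ u = s at hs
    rcases hcut with h0 | h0
    · refine ⟨0, ?_, by simpa using cut_nonneg _, by simp; omega, by simpa using hs⟩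
      simpa using dvd_of_cnorm_eq_zero hk h0
    · have h2 := Int.emod_nonneg (τ v) (show (2 * k : ℤ) ≠ 0 by omega)
      have h3 := Int.emod_lt_of_pos (τ v) (show (0 : ℤ) < 2 * k by omega)
      have h4 := Int.emod_nonneg (-τ v) (show (2 * k : ℤ) ≠ 0 by omega)
      have h5 := Int.emod_lt_of_pos (-τ v) (show (0 : ℤ) < 2 * k by omega)
      have h6 := cnorm_nonneg (k := k) (τ v)
      rw [_root_.abs_lt] at hs
      -- Of the two representatives of $\tau(v)$ in $(-2k,2k)$, the one with the sign of $s$ keeps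
      -- $|s-r|$ below $2k$; the degree of $v$ is at least $2k$, so it can be realised.
      rcases le_total 0 s with h7 | h7
      · refine ⟨τ v % (2 * k), dvd_of_eq_neg (Int.dvd_self_sub_emod (x := τ v)) (by ring), ?_, ?_,
          ?_⟩
        · rw [abs_of_nonneg h2]; omega
        · rw [abs_of_nonneg h2]; exact h3
        · rw [_root_.abs_lt]; omega
      · refine ⟨-(-τ v % (2 * k)), (Int.dvd_self_sub_emod (x := -τ v)).trans
          (dvd_of_eq (by ring)), ?_, ?_, ?_⟩
        · rw [abs_neg, abs_of_nonneg h4]; omega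
        · rw [abs_neg, abs_of_nonneg h4]; exact h5
        · rw [_root_.abs_lt]; omega
  have hrpar : (2 : ℤ) ∣ cut F p q {v} - r := by
    have := (dvd_mul_right (2 : ℤ) (k : ℤ)).trans hr
    omega
  obtain ⟨σ, hσ, hσv, hσe⟩ := exists_flow_eq {v} hr' hrpar hσ₁
  have hδ : δ v = 0 := by
    have := h.abs_le v hvW
    rw [hc] at this
    exact abs_eq_zero.1 (le_antisymm this (abs_nonneg _))
  have hsame : ∀ B : Finset α, ind B v = ind B y → flow F p q σ B = flow F p q σ₁ B := by
    intro B hB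
    refine Finset.sum_congr rfl fun e he => ?_
    by_cases hev : ind {v} (p e) = ind {v} (q e)
    · rw [hσe e he hev]
    · have : ind B (p e) = ind B (q e) := by
        by_cases hp : p e = v
        · by_cases hq : q e = v
          · exact absurd (by rw [hp, hq]) hev
          · rw [hp, hall e he (q e) hq (.inl ⟨hp, rfl⟩), hB]
        · by_cases hq : q e = v
          · rw [hq, hall e he (p e) hp (.inr ⟨rfl, hq⟩), hB]
          · simp [ind, hp, hq] at hev
      rw [this]; ring
  refine ⟨σ, hσ, fun u hu => ?_⟩
  by_cases huv : u = v
  · subst huv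
    rw [hσv, hδ, sub_zero]
    exact ⟨hr, hr2⟩
  by_cases huy : u = y
  · subst huy
    have hfl : flow F p q σ₁ {v, u} = r + flow F p q σ {u} := by
      rw [← hsame {v, u} (by simp [ind]), flow_eq_sum, Finset.sum_pair (Ne.symm huv), hσv]
    rw [hfl, Finset.sum_pair (Ne.symm huv), hδ] at h1y hrs
    rw [Finset.sum_pair (Ne.symm huv)] at h1y
    refine ⟨(dvd_sub h1y.1 hr).trans (dvd_of_eq (by ring)), ?_⟩
    rwa [show flow F p q σ {u} - δ u = r + flow F p q σ {u} - (0 + δ u) - r by ring]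
  · have h1u := h1 u (Finset.mem_image.2 ⟨u, hu, hφn u huv⟩)
    simp only [flow_image h.ends, Finset.mem_singleton, fiberSum, hfu u hu huv huy,
      Finset.sum_singleton] at h1u
    rwa [hsame {u} (by rw [ind_notMem, ind_notMem] <;> simp [Ne.symm huv, Ne.symm huy])]

/-- A vertex with prescribed value zero, or whose degree exceeds the bound. -/
theorem solvable_of_loose (hk : 0 < k) (h : RootedInstance k W F p q c δ τ v)
    (IH : SolvableBelow α β k (F.card + W.card))
    (hS : ∀ A ⊆ W, 2 ≤ A.card → A ≠ W →
      2 * k + cnorm k (∑ v ∈ A, τ v) ≤ cut F p q A + ∑ v ∈ A, c v)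
    (hvW : v ∈ W) (hW : W ≠ {v})
    (hv : cnorm k (τ v) = 0 ∨ 2 * k + cnorm k (τ v) ≤ cut F p q {v} + c v) :
    Solvable k W F p q δ τ := by
  by_cases hc : c v = 0
  · by_cases h2 : ∃ e ∈ F, ∃ f ∈ F, ∃ y w, y ≠ v ∧ w ≠ v ∧ y ≠ w ∧ Joins p q e v y ∧
        Joins p q f v w
    · obtain ⟨e, he, f, hf, y, w, hy, hw, hyw, hey, hfw⟩ := h2
      exact h.solvable_of_lift IH hS hv he hf hyw hey hfw
    · push Not at h2
      rw [hc, add_zero] at hv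
      by_cases h1 : ∃ e ∈ F, ∃ y, y ≠ v ∧ Joins p q e v y
      · obtain ⟨e, he, y, hy, hey⟩ := h1
        refine h.solvable_of_one_neighbor hk IH hvW (hey.mem h.ends he).2 hy hc hv
          fun f hf w hw hfw => ?_
        by_contra hwy
        exact h2 f hf e he w y hw hy hwy hfw hey
      · push Not at h1
        obtain ⟨y, hy⟩ : ∃ y ∈ W, y ≠ v := by
          by_contra! hn
          exact hW (Finset.eq_singleton_iff_unique_mem.2 ⟨hvW, hn⟩)
        exact h.solvable_of_one_neighbor hk IH hvW hy.1 hy.2 hc hv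
          fun f hf w hw hfw => absurd hfw (h1 f hf w hw)
  · obtain ⟨e, he, u, hu, w, hw, hj⟩ :=
      exists_joins_of_cut_ne_zero (h.cut_ne_zero_of_loose hk hvW hW hv hc)
    rw [Finset.mem_singleton] at hu hw
    subst hu
    exact h.solvable_of_root_lift IH hS hv he (Ne.symm hw) hj hc

end RootedInstance

end Loose

/-! ### Instances in which every degree equals its bound, and the main induction. -/

section Critical

variable {k : ℕ}

/-- Directing an edge out of a vertex lowers its remaining residue by $1$, directing one in raises
it. Call a vertex positive if the former reduces the norm and negative if the latter does. A vertex
of nonzero residue has at least one of these signs, and both only for residue $k$. -/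
theorem cnorm_sub_one_lt_or {z : ℤ} (hk : 0 < k) (hz : cnorm k z ≠ 0) :
    cnorm k (z - 1) < cnorm k z ∨ cnorm k (z + 1) < cnorm k z := by
  obtain ⟨r, hr, h1, h2⟩ := exists_cnorm_rep hk z
  rw [h2] at hz ⊢
  rcases abs_cases r with ⟨h, h'⟩ | ⟨h, h'⟩
  · left
    rw [sub_eq_add_neg, cnorm_shift h1, cnorm_eq_abs hk (by rw [abs_le]; omega),
      abs_of_nonneg (by omega)]
    omega
  · right
    rw [cnorm_shift h1, cnorm_eq_abs hk (by rw [abs_le]; omega), abs_of_nonpos (by omega)]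
    omega

theorem exists_pos_rep {z : ℤ} (hk : 0 < k) (hp : cnorm k (z - 1) < cnorm k z)
    (hn : ¬cnorm k (z + 1) < cnorm k z) :
    ∃ r : ℤ, 0 < r ∧ r < k ∧ (2 * k : ℤ) ∣ z - r ∧ cnorm k z = r := by
  obtain ⟨r, hr, h1, h2⟩ := exists_cnorm_rep hk z
  have h0 := cnorm_nonneg (k := k) (z - 1)
  rw [cnorm_shift h1] at hn
  rw [h2] at hp hn ⊢
  rcases abs_cases r with ⟨h, h'⟩ | ⟨h, h'⟩
  · refine ⟨r, by omega, ?_, h1, h⟩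
    by_contra hrk
    rw [cnorm_of_between hk (by omega) (by omega), abs_of_nonpos (by omega)] at hn
    omega
  · rw [cnorm_eq_abs hk (by rw [abs_le]; omega), abs_of_nonpos (by omega)] at hn
    omega

variable {α β : Type*} [DecidableEq α]
variable {W : Finset α} {F : Finset β} {p q : β → α} {c δ τ : α → ℤ} {v v₀ : α}

namespace RootedInstance

/-- If all degrees equal the bound, it suffices to solve the problem modulo `2 * k`. -/
theorem solvable_of_modEq (hk : 0 < k) (h : RootedInstance k W F p q c δ τ v₀)
    (hT : ∀ v ∈ W, cut F p q {v} + c v = 2 * k - 2 + cnorm k (τ v)) {σ : β → ℤ}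
    (hσ : IsOrientation σ) (hs : ∀ v ∈ W, (2 * k : ℤ) ∣ flow F p q σ {v} - δ v - τ v) :
    Solvable k W F p q δ τ :=
  -- The net out-degree is at most the total degree $2k-2+\|\tau(v)\|$ in absolute value; in its
  -- residue class that forces it below $2k$.
  ⟨σ, hσ, fun v hv => ⟨hs v hv, abs_lt_of_le_cnorm hk (hs v hv) <| (hT v hv) ▸
    (abs_sub _ _).trans (add_le_add (hσ.abs_flow_le _) (h.abs_le v hv))⟩⟩

/-- The root arcs at `v` may be deleted one by one. -/
theorem deleteArc (hk : 0 < k) (h : RootedInstance k W F p q c δ τ v₀)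
    (hS : ∀ A ⊆ W, 2 ≤ A.card → A ≠ W →
      2 * k + cnorm k (∑ v ∈ A, τ v) ≤ cut F p q A + ∑ v ∈ A, c v)
    (hT : ∀ v ∈ W, cut F p q {v} + c v = 2 * k - 2 + cnorm k (τ v))
    (hv : v ∈ W) (hneg : cnorm k (τ v + 1) < cnorm k (τ v)) (hδ : δ v ≠ -c v) :
    RootedInstance k W F p q (fun u => c u + (-1) * ind {v} u) (fun u => δ u + (-1) * ind {v} u)
      (fun u => τ u + 1 * ind {v} u) v₀ := by
  refine ⟨h.ends, fun u hu => ?_, fun u hu => ?_, fun A hA => ?_, ?_, ?_, fun A hA h1 h2 => ?_⟩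
  · have h1 := h.abs_le u hu
    have h2 := h.two_dvd u hu
    by_cases huv : u = v
    · subst huv
      rw [ind_mem (Finset.mem_singleton_self u)]
      rw [_root_.abs_le] at h1 ⊢
      omega
    · rw [ind_notMem (by simpa using huv)]
      simpa using h1
  · have := h.two_dvd u hu
    omega
  · have := h.parity A hA
    rw [sum_add_mul_ind, sum_add_mul_ind]
    omega
  · rw [sum_add_mul_ind, sum_add_mul_ind]
    exact h.total.trans (dvd_of_eq (by ring))
  · rw [sum_add_mul_ind, sum_add_mul_ind, ind_mem hv]
    have h1 := h.root
    have h2 := cnorm_add_le_abs hk (∑ u ∈ W, δ u + -1 * 1) 1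
    rw [show ∑ u ∈ W, δ u + -1 * 1 + 1 = ∑ u ∈ W, δ u by ring, abs_one] at h2
    omega
  · right
    rw [sum_add_mul_ind, sum_add_mul_ind]
    rcases eq_singleton_or_two_le_card h1 with ⟨x, rfl⟩ | hc
    · have h3 := hT x (by simpa using hA)
      simp only [Finset.sum_singleton]
      rcases ind_cases {x} v with ⟨h4, h5⟩ | ⟨-, h5⟩ <;> rw [h5]
      · rw [Finset.mem_singleton] at h4
        subst h4
        rw [mul_one]
        omega
      · rw [mul_zero, add_zero]
        omega
    · have h3 := hS A hA hc h2
      rcases ind_cases A v with ⟨-, h5⟩ | ⟨-, h5⟩ <;> rw [h5]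
      · have h4 := cnorm_add_le_abs hk (∑ u ∈ A, τ u) (1 * 1)
        norm_num at h4 ⊢
        omega
      · rw [mul_zero, add_zero]
        omega

/-- Directing an edge from `u` to `x`, and possibly changing the root arcs at `x`. -/
theorem solvable_of_orient_edge [DecidableEq β] (hk : 0 < k)
    (h : RootedInstance k W F p q c δ τ v₀)
    (IH : SolvableBelow α β k (F.card + W.card))
    (hS : ∀ A ⊆ W, 2 ≤ A.card → A ≠ W →
      2 * k + cnorm k (∑ v ∈ A, τ v) ≤ cut F p q A + ∑ v ∈ A, c v)
    (hT : ∀ v ∈ W, cut F p q {v} + c v = 2 * k - 2 + cnorm k (τ v))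
    {e : β} {u x : α} (he : e ∈ F) (hux : u ≠ x) (hj : Joins p q e u x)
    (hu : cnorm k (τ u - 1) < cnorm k (τ u)) {a b s : ℤ} (hbs : b + s = 1) (hab : |b| ≤ a)
    (hab2 : (2 : ℤ) ∣ a - b) (hx : cnorm k (τ x + s) < cnorm k (τ x) + a)
    (hroot : ∑ v ∈ W, c v + a ≤ 2 * k - 2 + cnorm k (∑ v ∈ W, δ v + b)) :
    Solvable k W F p q δ τ := by
  have hcard := Finset.card_erase_lt_of_mem he
  obtain ⟨huW, hxW⟩ := hj.mem h.ends he
  have hcut := cut_erase he hj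
  -- At $x$ the directed edge is traded for $a$ root arcs of net inflow $b$; the remaining effect
  -- $s=1-b$ goes into the residue. The number of root arcs may grow, since an edge away from the
  -- root is lost.
  have hnew : RootedInstance k W (F.erase e) p q (fun w => c w + a * ind {x} w)
      (fun w => δ w + b * ind {x} w) (fun w => τ w + (-1) * ind {u} w + s * ind {x} w) v₀ := by
    refine ⟨fun g hg => h.ends g (Finset.mem_of_mem_erase hg), fun w hw => ?_, fun w hw => ?_,
      fun A hA => ?_, ?_, ?_, fun A hA h1 h2 => ?_⟩
    · have h1 := h.abs_le w hw
      rcases ind_cases {x} w with ⟨-, i⟩ | ⟨-, i⟩ <;> rw [i]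
      · rw [mul_one, mul_one]
        exact (abs_add_le _ _).trans (add_le_add h1 hab)
      · simpa using h1
    · have h1 := h.two_dvd w hw
      rcases ind_cases {x} w with ⟨-, i⟩ | ⟨-, i⟩ <;> rw [i] <;> omega
    · have h1 := h.parity A hA
      rw [hcut] at h1
      rw [sum_add_mul_ind, sum_add_mul_ind, sum_add_mul_ind]
      rcases ind_cases A u with ⟨-, i1⟩ | ⟨-, i1⟩ <;>
        rcases ind_cases A x with ⟨-, i2⟩ | ⟨-, i2⟩ <;>
        rw [i1, i2] at h1 ⊢ <;> norm_num at h1 ⊢ <;> omega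
    · rw [sum_add_mul_ind, sum_add_mul_ind, sum_add_mul_ind, ind_mem huW, ind_mem hxW]
      refine h.total.trans (dvd_of_eq ?_)
      linarith
    · rw [sum_add_mul_ind, sum_add_mul_ind, ind_mem hxW, mul_one, mul_one]
      exact hroot
    · right
      rw [sum_add_mul_ind, sum_add_mul_ind, sum_add_mul_ind]
      rcases eq_singleton_or_two_le_card h1 with ⟨w, rfl⟩ | hc
      · have h3 := hT w (by simpa using hA)
        rw [hcut] at h3
        simp only [Finset.sum_singleton]
        rcases ind_cases {w} u with ⟨a1, i1⟩ | ⟨a1, i1⟩ <;>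
          rcases ind_cases {w} x with ⟨a2, i2⟩ | ⟨a2, i2⟩ <;> rw [i1, i2] at h3 ⊢ <;>
          rw [Finset.mem_singleton] at a1 a2 <;> norm_num at h3 ⊢
        · exact absurd (a1.trans a2.symm) hux
        · subst a1
          rw [← sub_eq_add_neg]
          omega
        · subst a2
          omega
        · omega
      -- If $A$ contains both ends, the residue of $A$ moves by $-b$, paid for by the $a\ge|b|$ new
      -- arcs. If it contains just one end, the lost edge and the further unit of residue use up the
      -- slack of $2$.
      · have h3 := hS A hA hc h2
        rw [hcut] at h3
        rcases ind_cases A u with ⟨-, i1⟩ | ⟨-, i1⟩ <;>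
          rcases ind_cases A x with ⟨-, i2⟩ | ⟨-, i2⟩ <;> rw [i1, i2] at h3 ⊢ <;> norm_num at h3 ⊢
        · have h4 := cnorm_add_le_abs hk (∑ v ∈ A, τ v) (-b)
          rw [abs_neg] at h4
          rw [show ∑ v ∈ A, τ v + -1 + s = ∑ v ∈ A, τ v + -b by linarith]
          omega
        · have h4 := cnorm_add_le_abs hk (∑ v ∈ A, τ v) (-1)
          norm_num at h4
          omega
        · have h4 := cnorm_add_le_abs hk (∑ v ∈ A, τ v) s
          have h5 : |s| ≤ 1 + |b| := by
            rw [show s = 1 - b by linarith]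
            exact (abs_sub _ _).trans (by norm_num)
          omega
        · omega
  obtain ⟨σ, hσ, hs⟩ := IH _ _ _ _ _ _ _ _ (by omega) hnew
  obtain ⟨σ', hσ', -, hf⟩ := exists_orient_edge he hj hσ
  refine h.solvable_of_modEq hk hT hσ' fun w hw => (hs w hw).1.trans (dvd_of_eq ?_)
  rw [hf, ind_singleton_comm w u, ind_singleton_comm w x]
  linear_combination (-ind {x} w) * hbs

theorem solvable_of_orient_edge_of_neg [DecidableEq β] (hk : 0 < k)
    (h : RootedInstance k W F p q c δ τ v₀)
    (IH : SolvableBelow α β k (F.card + W.card))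
    (hS : ∀ A ⊆ W, 2 ≤ A.card → A ≠ W →
      2 * k + cnorm k (∑ v ∈ A, τ v) ≤ cut F p q A + ∑ v ∈ A, c v)
    (hT : ∀ v ∈ W, cut F p q {v} + c v = 2 * k - 2 + cnorm k (τ v))
    {e : β} {u x : α} (he : e ∈ F) (hux : u ≠ x) (hj : Joins p q e u x)
    (hu : cnorm k (τ u - 1) < cnorm k (τ u)) (hx : cnorm k (τ x + 1) < cnorm k (τ x)) :
    Solvable k W F p q δ τ :=
  h.solvable_of_orient_edge hk IH hS hT he hux hj hu (a := 0) (b := 0) (s := 1) (by norm_num)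
    (by simp) (by simp) (by simpa using hx) (by simpa using h.root)

/-- An instance in which no prescribed value is zero is connected even without the root. -/
theorem cut_ne_zero (hk : 2 ≤ k) (h : RootedInstance k W F p q c δ τ v₀)
    (hτ : ∀ v ∈ W, cnorm k (τ v) ≠ 0) {A : Finset α} (hA : A ⊆ W) (hA1 : A.Nonempty)
    (hA2 : A ≠ W) : cut F p q A ≠ 0 := by
  intro h0
  have hb : ∀ B ⊆ W, B.Nonempty → B ≠ W →
      2 * k - 2 + cnorm k (∑ v ∈ B, τ v) ≤ cut F p q B + ∑ v ∈ B, c v := fun B h1 h2 h3 =>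
    (h.bound B h1 h2 h3).resolve_left fun h4 => hτ v₀ (h1 (by simp [h4.1])) h4.2
  have h1 := hb A hA hA1 hA2
  have h2 := hb (W \ A) Finset.sdiff_subset
    (Finset.sdiff_nonempty.2 fun h' => hA2 (hA.antisymm h')) (fun h' => by
      obtain ⟨x, hx⟩ := hA1
      have : x ∈ W \ A := h'.symm ▸ hA hx
      exact (Finset.mem_sdiff.1 this).2 hx)
  rw [cut_compl h.ends] at h2
  have h3 := h.root
  rw [h.cnorm_sum_δ (by omega), ← Finset.sum_sdiff hA, ← Finset.sum_sdiff hA] at h3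
  have h4 := cnorm_add_le (by omega) (∑ v ∈ W \ A, τ v) (∑ v ∈ A, τ v) (k := k)
  omega

/-- All prescribed values are, up to multiples of `2 * k`, strictly between `0` and `k`. -/
theorem solvable_of_all_pos [DecidableEq β] (hk : 0 < k)
    (h : RootedInstance k W F p q c δ τ v₀)
    (IH : SolvableBelow α β k (F.card + W.card))
    (hS : ∀ A ⊆ W, 2 ≤ A.card → A ≠ W →
      2 * k + cnorm k (∑ v ∈ A, τ v) ≤ cut F p q A + ∑ v ∈ A, c v)
    (hT : ∀ v ∈ W, cut F p q {v} + c v = 2 * k - 2 + cnorm k (τ v)) (hW : 2 ≤ W.card)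
    (hpos : ∀ v ∈ W, cnorm k (τ v - 1) < cnorm k (τ v))
    (hneg : ∀ v ∈ W, ¬cnorm k (τ v + 1) < cnorm k (τ v)) (hδ : ∀ v ∈ W, δ v = c v) :
    Solvable k W F p q δ τ := by
  obtain ⟨w, hw⟩ : W.Nonempty := Finset.card_pos.1 (by omega)
  have hτ : ∀ v ∈ W, cnorm k (τ v) ≠ 0 := fun v hv => by
    have := hpos v hv
    have := cnorm_nonneg (k := k) (τ v - 1)
    omega
  have hk2 : 2 ≤ k := by
    obtain ⟨r, h1, h2, -⟩ := exists_pos_rep hk (hpos w hw) (hneg w hw)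
    omega
  obtain ⟨e, he, u, hu, x, hx, hj⟩ := exists_joins_of_cut_ne_zero
    (h.cut_ne_zero hk2 hτ (Finset.singleton_subset_iff.2 hw) (Finset.singleton_nonempty w)
      (fun h' => by rw [← h', Finset.card_singleton] at hW; omega))
  rw [Finset.mem_singleton] at hu hx
  subst hu
  have hxW := (hj.mem h.ends he).2
  have hsum : ∑ v ∈ W, δ v = ∑ v ∈ W, c v := Finset.sum_congr rfl hδ
  have hC0 : 0 ≤ ∑ v ∈ W, c v :=
    Finset.sum_nonneg fun v hv => (abs_nonneg _).trans (h.abs_le v hv)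
  have hroot := h.root
  rw [hsum] at hroot
  have hC := abs_lt_of_le_cnorm hk (z := ∑ v ∈ W, c v) (by simp)
    ((abs_of_nonneg hC0).trans_le hroot)
  rw [abs_of_nonneg hC0] at hC
  by_cases hC1 : ∑ v ∈ W, c v = 2 * k - 1
  -- The root admits no further arc towards $x$. Adding $k-r$ arcs from $x$ to the root instead
  -- brings the residue of $x$ to $k+1$, of norm $k-1$, and both $x$ and the root then meet their
  -- bounds with equality.
  · obtain ⟨r, h1, h2, h3, h4⟩ := exists_pos_rep hk (hpos x hxW) (hneg x hxW)
    refine h.solvable_of_orient_edge hk IH hS hT he (Ne.symm hx) hj (hpos u hw) (a := k - r)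
      (b := -(k - r)) (s := k - r + 1) (by ring) (by rw [abs_neg, abs_of_nonneg (by omega)])
      (by omega) ?_ ?_
    · rw [h4, cnorm_shift h3, cnorm_of_between hk (by omega) (by omega), abs_of_nonpos (by omega)]
      omega
    · rw [hsum, hC1, cnorm_of_between hk (by omega) (by omega), abs_of_nonpos (by omega)]
      omega
  -- Here the root has room: the edge from $u$ to $x$ becomes an arc from the root to $x$, so the
  -- residue of $x$ is unchanged.
  · refine h.solvable_of_orient_edge hk IH hS hT he (Ne.symm hx) hj (hpos u hw) (a := 1)
      (b := 1) (s := 0) (by norm_num) (by simp) (by simp) (by simp) ?_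
    rw [hsum]
    have := abs_le_of_abs_lt hk (t := ∑ v ∈ W, c v + 1) (by rw [abs_of_nonneg] <;> omega)
    rwa [abs_of_nonneg (by omega)] at this

/-- A root arc leaving a positive vertex or entering a negative one can be deleted, and an edge
between a positive and a negative vertex can be directed towards the latter. When neither exists,
connectedness away from the root forces all vertices to have the same sign. -/
theorem solvable_of_critical [DecidableEq β] (hk : 0 < k)
    (h : RootedInstance k W F p q c δ τ v₀)
    (IH : SolvableBelow α β k (F.card + W.card))
    (IHc : ∀ c' δ' τ', ∑ v ∈ W, c' v < ∑ v ∈ W, c v →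
      RootedInstance k W F p q c' δ' τ' v₀ → Solvable k W F p q δ' τ')
    (hS : ∀ A ⊆ W, 2 ≤ A.card → A ≠ W →
      2 * k + cnorm k (∑ v ∈ A, τ v) ≤ cut F p q A + ∑ v ∈ A, c v)
    (hT : ∀ v ∈ W, cut F p q {v} + c v = 2 * k - 2 + cnorm k (τ v)) (hW : 2 ≤ W.card)
    (hτ : ∀ v ∈ W, cnorm k (τ v) ≠ 0) :
    Solvable k W F p q δ τ := by
  have hneg' : ∀ z : ℤ, cnorm k (-z + 1) = cnorm k (z - 1) ∧ cnorm k (-z - 1) = cnorm k (z + 1) :=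
    fun z => ⟨by rw [← cnorm_neg hk]; congr 1; ring, by rw [← cnorm_neg hk]; congr 1; ring⟩
  have hS' : ∀ A ⊆ W, 2 ≤ A.card → A ≠ W →
      2 * k + cnorm k (∑ v ∈ A, -τ v) ≤ cut F p q A + ∑ v ∈ A, c v := fun A h1 h2 h3 => by
    rw [Finset.sum_neg_distrib, cnorm_neg hk]
    exact hS A h1 h2 h3
  have hT' : ∀ v ∈ W, cut F p q {v} + c v = 2 * k - 2 + cnorm k (-τ v) := fun v hv => by
    rw [cnorm_neg hk]
    exact hT v hv
  have hlt : ∀ v ∈ W, ∑ u ∈ W, (c u + (-1) * ind {v} u) < ∑ u ∈ W, c u := fun v hv => by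
    rw [sum_add_mul_ind, ind_mem hv]
    omega
  by_cases hN : ∃ v ∈ W, cnorm k (τ v + 1) < cnorm k (τ v) ∧ δ v ≠ -c v
  · obtain ⟨v, hv, h1, h2⟩ := hN
    obtain ⟨σ, hσ, hs⟩ := IHc _ _ _ (hlt v hv) (h.deleteArc hk hS hT hv h1 h2)
    exact h.solvable_of_modEq hk hT hσ fun u hu => (hs u hu).1.trans (dvd_of_eq (by ring))
  by_cases hP : ∃ v ∈ W, cnorm k (τ v - 1) < cnorm k (τ v) ∧ δ v ≠ c v
  · obtain ⟨v, hv, h1, h2⟩ := hP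
    obtain ⟨σ, hσ, hs⟩ := IHc _ _ _ (hlt v hv) ((h.neg hk).deleteArc hk hS' hT' hv
      (by rwa [(hneg' _).1, cnorm_neg hk]) (fun h3 => h2 (neg_injective h3)))
    exact Solvable.neg ((h.neg hk).solvable_of_modEq hk hT' hσ fun u hu =>
      (hs u hu).1.trans (dvd_of_eq (by ring)))
  push Not at hN hP
  by_cases hE : ∃ e ∈ F, ∃ u x, u ≠ x ∧ Joins p q e u x ∧ cnorm k (τ u - 1) < cnorm k (τ u) ∧
      cnorm k (τ x + 1) < cnorm k (τ x)
  · obtain ⟨e, he, u, x, hux, hj, h1, h2⟩ := hE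
    exact h.solvable_of_orient_edge_of_neg hk IH hS hT he hux hj h1 h2
  push Not at hE
  -- A vertex with both signs has no root arcs left, hence a neighbour in $W$; whatever the sign of
  -- that neighbour, the edge between them violates `hE`.
  have hdisj : ∀ v ∈ W, cnorm k (τ v - 1) < cnorm k (τ v) → ¬cnorm k (τ v + 1) < cnorm k (τ v) := by
    intro v hv h1 h2
    have h3 := hN v hv h2
    have h4 := hP v hv h1
    have h5 := hT v hv
    have h6 := hτ v hv
    have h7 := cnorm_nonneg (k := k) (τ v)
    obtain ⟨e, he, u, hu, x, hx, hj⟩ := exists_joins_of_cut_ne_zero (F := F) (p := p) (q := q)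
      (A := {v}) (by omega)
    rw [Finset.mem_singleton] at hu hx
    subst hu
    rcases cnorm_sub_one_lt_or hk (hτ x (hj.mem h.ends he).2) with h8 | h8
    · exact absurd h2 (not_lt.2 (hE e he x u hx hj.symm h8))
    · exact absurd h8 (not_lt.2 (hE e he u x (Ne.symm hx) hj h1))
  by_cases hQ : ∀ v ∈ W, cnorm k (τ v - 1) < cnorm k (τ v)
  · exact h.solvable_of_all_pos hk IH hS hT hW hQ (fun v hv => hdisj v hv (hQ v hv))
      fun v hv => hP v hv (hQ v hv)
  by_cases hQ' : ∀ v ∈ W, cnorm k (τ v + 1) < cnorm k (τ v)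
  · refine Solvable.neg ((h.neg hk).solvable_of_all_pos hk IH hS' hT' hW (fun v hv => ?_)
      (fun v hv => ?_) fun v hv => ?_)
    · rw [(hneg' _).2, cnorm_neg hk]
      exact hQ' v hv
    · rw [(hneg' _).1, cnorm_neg hk]
      exact fun h1 => hdisj v hv h1 (hQ' v hv)
    · rw [hN v hv (hQ' v hv), neg_neg]
  push Not at hQ hQ'
  obtain ⟨y, hy, hy'⟩ := hQ
  obtain ⟨x, hx, hx'⟩ := hQ'
  have hxpos := (cnorm_sub_one_lt_or hk (hτ x hx)).resolve_right (not_lt.2 hx')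
  have hk2 : 2 ≤ k := by
    obtain ⟨r, h1, h2, -⟩ := exists_pos_rep hk hxpos (not_lt.2 hx')
    omega
  obtain ⟨e, he, a, ha, b, hb, hj⟩ := exists_joins_of_cut_ne_zero
    (h.cut_ne_zero hk2 hτ (A := W.filter fun v => cnorm k (τ v - 1) < cnorm k (τ v))
      (Finset.filter_subset _ _) ⟨x, Finset.mem_filter.2 ⟨hx, hxpos⟩⟩
      (fun h' => by
        rw [← h', Finset.mem_filter] at hy
        exact absurd hy.2 (not_lt.2 hy')))
  have hbW := (hj.mem h.ends he).2
  rw [Finset.mem_filter] at ha hb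
  have hbn := (cnorm_sub_one_lt_or hk (hτ b hbW)).resolve_left fun h' => hb ⟨hbW, h'⟩
  refine absurd hbn (not_lt.2 (hE e he a b ?_ hj ha.2))
  rintro rfl
  exact hb ha

theorem solvable_of_card_le_one (hk : 0 < k) (h : RootedInstance k W F p q c δ τ v₀)
    (hW : W.card ≤ 1) :
    Solvable k W F p q δ τ := by
  refine ⟨fun _ => 1, fun _ => .inl rfl, fun v hv => ?_⟩
  have hWv : W = {v} := Finset.eq_singleton_iff_unique_mem.2
    ⟨hv, fun x hx => Finset.card_le_one.1 hW x hx v hv⟩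
  have h1 : flow F p q (fun _ => 1) {v} = 0 := Finset.sum_eq_zero fun e he => by
    have := h.ends e he
    rw [hWv, Finset.mem_singleton, Finset.mem_singleton] at this
    rw [this.1, this.2]
    ring
  have h2 := h.total
  rw [hWv, Finset.sum_singleton, Finset.sum_singleton] at h2
  have h3 := h.root
  rw [hWv, Finset.sum_singleton, Finset.sum_singleton] at h3
  refine ⟨dvd_of_eq_neg h2 (by rw [h1]; ring), ?_⟩
  rw [h1, zero_sub, abs_neg]
  exact abs_lt_of_le_cnorm hk (z := δ v) (by simp) ((h.abs_le v hv).trans h3)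

theorem solvable_of_below [DecidableEq β] (hk : 0 < k)
    (h : RootedInstance k W F p q c δ τ v₀)
    (IH : SolvableBelow α β k (F.card + W.card))
    (IHc : ∀ c' δ' τ', ∑ v ∈ W, c' v < ∑ v ∈ W, c v →
      RootedInstance k W F p q c' δ' τ' v₀ → Solvable k W F p q δ' τ') :
    Solvable k W F p q δ τ := by
  rcases Nat.lt_or_ge 1 W.card with hW | hW
  swap
  · exact h.solvable_of_card_le_one hk hW
  have hWv : ∀ v, W ≠ {v} := fun v h' => by
    rw [h', Finset.card_singleton] at hW
    omega
  by_cases ht : ∃ A ⊆ W, 2 ≤ A.card ∧ A ≠ W ∧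
      cut F p q A + ∑ v ∈ A, c v ≤ 2 * k - 2 + cnorm k (∑ v ∈ A, τ v)
  · obtain ⟨A, h1, h2, h3, h4⟩ := ht
    exact h.solvable_of_tight hk IH h1 h2 h3 h4
  push Not at ht
  have hS : ∀ A ⊆ W, 2 ≤ A.card → A ≠ W →
      2 * k + cnorm k (∑ v ∈ A, τ v) ≤ cut F p q A + ∑ v ∈ A, c v := fun A h1 h2 h3 => by
    have h4 := ht A h1 h2 h3
    have h5 := h.parity A h1
    have h6 := cnorm_parity hk (∑ v ∈ A, τ v)
    omega
  -- An active exemption is used up first. Once there is none, all bounds hold and the exemption can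
  -- be given to any vertex.
  by_cases h0 : v₀ ∈ W ∧ cnorm k (τ v₀) = 0
  · exact h.solvable_of_loose hk IH hS h0.1 (hWv v₀) (.inl h0.2)
  have hb : ∀ A ⊆ W, A.Nonempty → A ≠ W →
      2 * k - 2 + cnorm k (∑ v ∈ A, τ v) ≤ cut F p q A + ∑ v ∈ A, c v := fun A h1 h2 h3 =>
    (h.bound A h1 h2 h3).resolve_left fun h4 => h0 ⟨h1 (by simp [h4.1]), h4.2⟩
  by_cases hl : ∃ v ∈ W, cnorm k (τ v) = 0 ∨ 2 * k + cnorm k (τ v) ≤ cut F p q {v} + c v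
  · obtain ⟨v, hv, hl⟩ := hl
    have h' : RootedInstance k W F p q c δ τ v := ⟨h.ends, h.abs_le, h.two_dvd, h.parity, h.total,
      h.root, fun A h1 h2 h3 => .inr (hb A h1 h2 h3)⟩
    exact h'.solvable_of_loose hk IH hS hv (hWv v) hl
  push Not at hl
  refine h.solvable_of_critical hk IH IHc hS (fun v hv => ?_) hW fun v hv => (hl v hv).1
  have h1 := hb {v} (by simpa using hv) (Finset.singleton_nonempty v) (hWv v).symm
  have h2 := (hl v hv).2
  have h3 := h.parity {v} (by simpa using hv)
  have h4 := cnorm_parity hk (τ v)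
  simp only [Finset.sum_singleton] at h1 h3
  omega

/-- Every rooted instance is solvable. -/
theorem solvable [DecidableEq β] (hk : 0 < k) (h : RootedInstance k W F p q c δ τ v₀) :
    Solvable k W F p q δ τ := by
  have key : ∀ n, SolvableBelow α β k n := by
    intro n
    induction n with
    | zero => exact fun _ _ _ _ _ _ _ _ h _ => absurd h (Nat.not_lt_zero _)
    | succ n ih =>
      intro W F p q c δ τ v₀ hn h
      have IH : SolvableBelow α β k (F.card + W.card) := fun _ _ _ _ _ _ _ _ h1 h2 =>
        ih _ _ _ _ _ _ _ _ (by omega) h2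
      -- Deleting root arcs leaves $W$ and $F$ unchanged, hence a second induction on the degree of
      -- the root.
      induction hm : (∑ v ∈ W, c v).toNat using Nat.strong_induction_on generalizing c δ τ with
      | _ m ihm =>
        refine h.solvable_of_below hk IH fun c' δ' τ' hlt h' => ?_
        have h0 : 0 ≤ ∑ v ∈ W, c' v :=
          Finset.sum_nonneg fun v hv => (abs_nonneg _).trans (h'.abs_le v hv)
        exact ihm _ (by omega) c' δ' τ' h' rfl
  exact key _ W F p q c δ τ v₀ (Nat.lt_succ_self _) h

end RootedInstance

end Critical

/-! ### Prescribing the degree at one vertex. -/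

section Bounded

variable {α β : Type*} [DecidableEq α] [DecidableEq β]

/-- Orientations with prescribed degrees modulo `2 * k`, nearly balanced at every vertex, and with
a prescribed degree at one vertex. -/
theorem exists_orientation {k : ℕ} (hk : 0 < k) {W : Finset α} {F : Finset β} {p q : β → α}
    {τ : α → ℤ} (ends : ∀ e ∈ F, p e ∈ W ∧ q e ∈ W)
    (parity : ∀ A ⊆ W, (2 : ℤ) ∣ cut F p q A - ∑ v ∈ A, τ v)
    (total : (2 * k : ℤ) ∣ ∑ v ∈ W, τ v)
    (bound : ∀ A ⊆ W, A.Nonempty → A ≠ W → 2 * k - 2 + cnorm k (∑ v ∈ A, τ v) ≤ cut F p q A)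
    {z : α} (hz : z ∈ W) {t : ℤ} (ht : (2 * k : ℤ) ∣ t - τ z) (htk : |t| < 2 * k) :
    ∃ σ, IsOrientation σ ∧
      (∀ v ∈ W, (2 * k : ℤ) ∣ flow F p q σ {v} - τ v ∧ |flow F p q σ {v}| < 2 * k) ∧
      flow F p q σ {z} = t := by
  have habs : (2 : ℤ) ∣ |t| - t := by
    rcases abs_cases t with ⟨h, -⟩ | ⟨h, -⟩ <;> rw [h] <;> omega
  -- The root gets $|t|$ arcs, all at $z$ and all in the direction given by the sign of $t$. The
  -- residue of $z$ becomes $0$, so a solution has net flow at $z$ differing from $t$ by a multiple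
  -- of $2k$ of absolute value less than $2k$.
  have hinst : RootedInstance k W F p q (fun v => 0 + |t| * ind {z} v)
      (fun v => 0 + t * ind {z} v) (fun v => τ v + (-t) * ind {z} v) z := by
    refine ⟨ends, fun v _ => ?_, fun v _ => ?_, fun A hA => ?_, ?_, ?_, fun A hA h1 h2 => ?_⟩
    · rcases ind_cases {z} v with ⟨-, i⟩ | ⟨-, i⟩ <;> rw [i] <;> simp
    · rcases ind_cases {z} v with ⟨-, i⟩ | ⟨-, i⟩ <;> rw [i] <;> simp [habs]
    · have := parity A hA
      rw [sum_add_mul_ind, sum_add_mul_ind, Finset.sum_const_zero]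
      rcases ind_cases A z with ⟨-, i⟩ | ⟨-, i⟩ <;> rw [i] <;> omega
    · rw [sum_add_mul_ind, sum_add_mul_ind, Finset.sum_const_zero]
      exact total.trans (dvd_of_eq (by ring))
    · rw [sum_add_mul_ind, sum_add_mul_ind, Finset.sum_const_zero, ind_mem hz]
      simpa using abs_le_of_abs_lt hk htk
    · by_cases hAz : A = {z}
      · refine .inl ⟨hAz, cnorm_eq_zero_of_dvd hk ?_⟩
        rw [ind_mem (Finset.mem_singleton_self z)]
        exact dvd_of_eq_neg ht (by ring)
      · right
        have h3 := bound A hA h1 h2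
        rw [sum_add_mul_ind, sum_add_mul_ind, Finset.sum_const_zero]
        rcases ind_cases A z with ⟨-, i⟩ | ⟨-, i⟩ <;> rw [i]
        · have h4 := cnorm_add_le_abs hk (∑ v ∈ A, τ v) (-t)
          rw [abs_neg] at h4
          rw [mul_one, mul_one]
          omega
        · rw [mul_zero, mul_zero, add_zero]
          omega
  obtain ⟨σ, hσ, hs⟩ := hinst.solvable hk
  beta_reduce at hs
  have hfz : flow F p q σ {z} = t := by
    have h1 := hs z hz
    rw [ind_mem (Finset.mem_singleton_self z)] at h1
    have h2 : (2 * k : ℤ) ∣ flow F p q σ {z} - t :=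
      (dvd_sub h1.1 ht).trans (dvd_of_eq (by ring))
    have h3 := Int.eq_zero_of_abs_lt_dvd h2 (by simpa using h1.2)
    omega
  refine ⟨σ, hσ, fun v hv => ?_, hfz⟩
  by_cases hvz : v = z
  · subst hvz
    rw [hfz]
    exact ⟨ht, htk⟩
  · have h1 := hs v hv
    rw [ind_notMem (by simpa using hvz : v ∉ {z})] at h1
    simpa using h1

end Bounded

/-! ### From factors of bipartite graphs to orientations. -/

section Factor

variable {α β : Type*}

/-- The norm is at most $k$ and has the parity of $d$. If it equals $k$, then $d\ne 3k-3$ by parity,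
so $d\ge 3k-2$. -/
theorem le_of_three_mul_le {k : ℕ} (hk : 0 < k) {d s : ℤ} (hd : 3 * (k : ℤ) - 3 ≤ d)
    (h2 : (2 : ℤ) ∣ d - s) : 2 * k - 2 + cnorm k s ≤ d := by
  have h1 := cnorm_le hk s
  have h3 := cnorm_parity hk s
  omega

/-- With $d=2k-1+a+j$ and $j\ge 0$, the residue is $a+1-j$ modulo $2k$. Since $a+1\ge 0$, its norm
is at most $a+1+j=d-(2k-2)$. -/
theorem le_of_bracket_le {k : ℕ} (hk : 0 < k) {d a s : ℤ} (ha : -1 ≤ a)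
    (hd : 2 * (k : ℤ) - 1 + a ≤ d) (h : (2 * k : ℤ) ∣ s - (2 * a - d)) :
    2 * k - 2 + cnorm k s ≤ d := by
  have h1 : cnorm k s = cnorm k (a + 1 - (d - (2 * k - 1 + a))) :=
    cnorm_congr ((dvd_sub h (dvd_refl (2 * k : ℤ))).trans (dvd_of_eq (by ring)))
  have h2 := cnorm_le_abs hk (a + 1 - (d - (2 * k - 1 + a)))
  have h3 : |a + 1 - (d - (2 * k - 1 + a))| ≤ a + 1 + (d - (2 * k - 1 + a)) := by
    rw [abs_le]; omega
  omega

theorem inInterval_iff {G : Graph α β} {k : ℕ} {v : α} {t : ℤ} :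
    InInterval G k v t ↔ |2 * t - degree G v| < 2 * k := by
  rw [InInterval, abs_lt]
  omega

theorem exists_mem_interval {k : ℕ} (hk : 0 < k) (G : Graph α β) (v : α) (a : ZMod k) :
    ∃ t : ℤ, (t : ZMod k) = a ∧ InInterval G k v t := by
  have : NeZero k := ⟨hk.ne'⟩
  set l : ℤ := (degree G v : ℤ) / 2 - ((k : ℤ) - 1) with hl
  have h1 := Int.emod_nonneg ((a.val : ℤ) - l) (show (k : ℤ) ≠ 0 by omega)
  have h2 := Int.emod_lt_of_pos ((a.val : ℤ) - l) (show (0 : ℤ) < k by omega)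
  refine ⟨l + ((a.val : ℤ) - l) % k, ?_, ?_, ?_⟩
  · push_cast
    simp
  · omega
  · omega

/-- `1` on `X` and `-1` elsewhere. -/
noncomputable def side (X : Set α) (v : α) : ℤ :=
  open Classical in if v ∈ X then 1 else -1

theorem side_cases (X : Set α) (v : α) : side X v = 1 ∨ side X v = -1 := by
  by_cases h : v ∈ X <;> simp [side, h]

theorem abs_side_mul (X : Set α) (v : α) (s : ℤ) : |side X v * s| = |s| := by
  rcases side_cases X v with h | h <;> rw [h] <;> simp

theorem innerSize_eq_zero {G : Graph α β} {X Y : Set α} (hd : Disjoint X Y)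
    (hlink : ∀ e x y, G.IsLink e x y → (x ∈ X ∧ y ∈ Y) ∨ (x ∈ Y ∧ y ∈ X)) :
    innerSize G X = 0 ∧ innerSize G Y = 0 := by
  rw [Set.disjoint_left] at hd
  constructor
  all_goals
    rw [innerSize, ← Set.ncard_empty (α := β)]
    congr 1
    ext e
    simp only [Set.mem_ofPred_eq, Set.mem_empty_iff_false, iff_false, not_exists, not_and]
    intro x y h hx hy
    rcases hlink e x y h with ⟨h1, h2⟩ | ⟨h1, h2⟩
  · exact hd hy h2
  · exact hd hx h1
  · exact hd h1 hx
  · exact hd h2 hy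

/-- No edge lies inside $X$ or $Y$, so the correction terms in compatibility vanish and the two sums
of $f$ agree. -/
theorem dvd_sum_side_mul {G : Graph α β} {k : ℕ} (hk : 0 < k) {f : α → ZMod k} {X Y : Set α}
    (hXY : IsVertexBipartition G X Y)
    (hlink : ∀ e x y, G.IsLink e x y → (x ∈ X ∧ y ∈ Y) ∨ (x ∈ Y ∧ y ∈ X))
    (hf : IsCompatibleWrt G f X Y) {W : Finset α} (hW : ∀ v, v ∈ W ↔ v ∈ G.vertexSet) :
    (k : ℤ) ∣ ∑ v ∈ W, side X v * (f v).val := by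
  classical
  have : NeZero k := ⟨hk.ne'⟩
  obtain ⟨hX0, hY0⟩ := innerSize_eq_zero hXY.1 hlink
  have hsum : ∑ᶠ v ∈ X, f v = ∑ᶠ v ∈ Y, f v := by
    rcases hf with ⟨x, hx, h⟩ | ⟨y, hy, h⟩
    · simpa [Nat.le_zero.1 (hX0 ▸ hx)] using h
    · simpa [Nat.le_zero.1 (hY0 ▸ hy)] using h
  have hmem : ∀ v, v ∈ W ↔ v ∈ X ∨ v ∈ Y := fun v => by rw [hW, ← hXY.2]; rfl
  have hXW : X = ↑(W.filter (· ∈ X)) := by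
    ext v
    simp only [Finset.coe_filter, Set.mem_ofPred_eq, hmem]
    tauto
  have hYW : Y = ↑(W.filter (· ∉ X)) := by
    ext v
    simp only [Finset.coe_filter, Set.mem_ofPred_eq, hmem]
    have h : v ∈ X → v ∉ Y := fun h => Set.disjoint_left.1 hXY.1 h
    tauto
  rw [← ZMod.intCast_zmod_eq_zero_iff_dvd]
  have h1 : ∑ᶠ v ∈ X, f v = ∑ v ∈ W.filter (· ∈ X), f v := by
    conv_lhs => rw [hXW]
    exact finsum_mem_coe_finset _ _
  have h2 : ∑ᶠ v ∈ Y, f v = ∑ v ∈ W.filter (· ∉ X), f v := by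
    conv_lhs => rw [hYW]
    exact finsum_mem_coe_finset _ _
  rw [h1, h2] at hsum
  push_cast
  rw [← Finset.sum_filter_add_sum_filter_not W (· ∈ X)]
  have h3 : ∑ v ∈ W.filter (· ∈ X), ((side X v : ℤ) : ZMod k) * ((f v).val : ZMod k) =
      ∑ v ∈ W.filter (· ∈ X), f v := Finset.sum_congr rfl fun v hv => by
    simp [side, (Finset.mem_filter.1 hv).2]
  have h4 : ∑ v ∈ W.filter (· ∉ X), ((side X v : ℤ) : ZMod k) * ((f v).val : ZMod k) =
      -∑ v ∈ W.filter (· ∉ X), f v := by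
    rw [← Finset.sum_neg_distrib]
    exact Finset.sum_congr rfl fun v hv => by simp [side, (Finset.mem_filter.1 hv).2]
  rw [h3, h4, hsum, add_neg_cancel]

variable [DecidableEq α]

theorem cutSize_eq_cut {G : Graph α β} {F : Finset β} {p q : β → α}
    (hF : ∀ e, e ∈ F ↔ e ∈ G.edgeSet) (hl : ∀ e ∈ F, G.IsLink e (p e) (q e)) (A : Finset α) :
    (cutSize G A : ℤ) = cut F p q A := by
  have h1 : cutEdges G A = ↑(F.filter fun e => ¬(p e ∈ A ↔ q e ∈ A)) := by
    ext e
    simp only [cutEdges, Set.mem_ofPred_eq, Finset.coe_filter, Finset.mem_coe]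
    constructor
    · rintro ⟨x, y, h, hx, hy⟩
      have he := (hF e).2 h.edge_mem
      refine ⟨he, ?_⟩
      rcases (hl e he).eq_and_eq_or_eq_and_eq h with ⟨h1, h2⟩ | ⟨h1, h2⟩ <;> simp [h1, h2, hx, hy]
    · rintro ⟨he, h⟩
      by_cases hp : p e ∈ A
      · exact ⟨_, _, hl e he, hp, fun hq => h ⟨fun _ => hq, fun _ => hp⟩⟩
      · refine ⟨_, _, (hl e he).symm, ?_, hp⟩
        by_contra hq
        exact h ⟨fun h => absurd h hp, fun h => absurd h hq⟩
  rw [cutSize, h1, Set.ncard_coe_finset, Finset.card_filter, Nat.cast_sum, cut]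
  refine Finset.sum_congr rfl fun e _ => ?_
  rcases ind_cases A (p e) with ⟨a1, i1⟩ | ⟨a1, i1⟩ <;>
    rcases ind_cases A (q e) with ⟨a2, i2⟩ | ⟨a2, i2⟩ <;> simp [a1, a2, i1, i2]

theorem degree_eq_cut {G : Graph α β} {F : Finset β} {p q : β → α}
    (hF : ∀ e, e ∈ F ↔ e ∈ G.edgeSet) (hl : ∀ e ∈ F, G.IsLink e (p e) (q e))
    (hpq : ∀ e ∈ F, p e ≠ q e) (v : α) : (degree G v : ℤ) = cut F p q {v} := by
  have hloop : ∀ e x, ¬G.IsLink e x x := fun e x h => by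
    have he := (hF e).2 h.edge_mem
    refine hpq e he ?_
    rcases (hl e he).eq_and_eq_or_eq_and_eq h with ⟨h1, h2⟩ | ⟨h1, h2⟩ <;> rw [h1, h2]
  have h1 : G.loopSet v = ∅ := by
    ext e
    simpa [Graph.loopSet] using hloop e v
  have h2 : G.incidenceSet v = cutEdges G ↑({v} : Finset α) := by
    ext e
    simp only [Graph.mem_incidenceSet, cutEdges, Set.mem_ofPred_eq, Finset.coe_singleton,
      Set.mem_singleton_iff]
    constructor
    · rintro ⟨y, h⟩
      exact ⟨v, y, h, rfl, fun h' => hloop e v (h' ▸ h)⟩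
    · rintro ⟨x, y, h, rfl, -⟩
      exact ⟨y, h⟩
  rw [← cutSize_eq_cut hF hl, degree, h1, h2, Set.ncard_empty, add_zero, cutSize]

theorem flow_one {F : Finset β} {p q : β → α} {X : Set α} (hX : ∀ e ∈ F, p e ∈ X ∧ q e ∉ X)
    (v : α) : flow F p q (fun _ => 1) {v} = side X v * cut F p q {v} := by
  rw [cut, Finset.mul_sum]
  refine Finset.sum_congr rfl fun e he => ?_
  obtain ⟨h1, h2⟩ := hX e he
  by_cases hv : v ∈ X
  · have h3 : q e ≠ v := fun h => h2 (h ▸ hv)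
    rw [ind_notMem (by simpa using h3 : q e ∉ {v})]
    rcases ind_cases {v} (p e) with ⟨-, i⟩ | ⟨-, i⟩ <;> simp [i, side, hv]
  · have h3 : p e ≠ v := fun h => hv (h ▸ h1)
    rw [ind_notMem (by simpa using h3 : p e ∉ {v})]
    rcases ind_cases {v} (q e) with ⟨-, i⟩ | ⟨-, i⟩ <;> simp [i, side, hv]

theorem flow_eq_two_mul_sub {F : Finset β} {p q : β → α} {σ : β → ℤ} (hσ : IsOrientation σ)
    (A : Finset α) : flow F p q σ A =
      2 * flow (F.filter fun e => σ e = 1) p q (fun _ => 1) A - flow F p q (fun _ => 1) A := by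
  rw [flow, flow, flow, Finset.sum_filter, Finset.mul_sum, ← Finset.sum_sub_distrib]
  refine Finset.sum_congr rfl fun e _ => ?_
  rcases hσ e with h | h <;> simp [h]
  ring

/-- The lower bound on the cuts that follows from the connectivity conditions. -/
theorem le_cut {G : Graph α β} {k : ℕ} (hk : 0 < k) {f : α → ZMod k} {W : Finset α}
    {F : Finset β} {p q : β → α} {X : Set α} {τ : α → ℤ} (hW : ∀ v, v ∈ W ↔ v ∈ G.vertexSet)
    (hF : ∀ e, e ∈ F ↔ e ∈ G.edgeSet) (hl : ∀ e ∈ F, G.IsLink e (p e) (q e))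
    (hpq : ∀ e ∈ F, p e ≠ q e)
    (hτ : ∀ v, τ v = side X v * (2 * (f v).val - degree G v))
    (parity : ∀ A ⊆ W, (2 : ℤ) ∣ cut F p q A - ∑ v ∈ A, τ v)
    (total : (2 * k : ℤ) ∣ ∑ v ∈ W, τ v)
    (hconn :
      (IsEssentiallyEdgeConnected G (3 * k - 3) ∧
        ∀ v ∈ G.vertexSet, 2 * (k : ℤ) - 1 + bracket (f v) ≤ (degree G v : ℤ)) ∨
      IsEdgeConnected G (3 * k - 3))
    {A : Finset α} (hA : A ⊆ W) (hA1 : A.Nonempty) (hA2 : A ≠ W) :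
    2 * k - 2 + cnorm k (∑ v ∈ A, τ v) ≤ cut F p q A := by
  have : NeZero k := ⟨hk.ne'⟩
  have hWG : (W : Set α) = G.vertexSet := Set.ext hW
  have hAG : (A : Set α) ⊆ G.vertexSet := hWG ▸ Finset.coe_subset.2 hA
  have ends : ∀ e ∈ F, p e ∈ W ∧ q e ∈ W := fun e he =>
    ⟨(hW _).2 (hl e he).left_mem, (hW _).2 (hl e he).right_mem⟩
  rcases hconn with ⟨hess, hdeg⟩ | hc
  · have hsing : ∀ v ∈ W, 2 * k - 2 + cnorm k (τ v) ≤ cut F p q {v} := fun v hv => by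
      rw [← degree_eq_cut hF hl hpq]
      obtain ⟨h1, h2, -⟩ := bracket_spec hk (f v)
      have h3 : (k : ℤ) ∣ (f v).val - bracket (f v) := by
        rw [← ZMod.intCast_zmod_eq_zero_iff_dvd]
        push_cast
        rw [h1]
        simp
      have h4 : cnorm k (τ v) = cnorm k (2 * (f v).val - degree G v) := by
        rw [hτ]
        rcases side_cases X v with h | h <;> rw [h]
        · rw [one_mul]
        · rw [neg_one_mul, cnorm_neg hk]
      rw [h4]
      exact le_of_bracket_le hk h2 (hdeg v ((hW v).1 hv))
        ((mul_dvd_mul_left 2 h3).trans (dvd_of_eq (by ring)))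
    rcases eq_singleton_or_two_le_card hA1 with ⟨v, rfl⟩ | hc
    · rw [Finset.sum_singleton]
      exact hsing v (by simpa using hA)
    have hB : (W \ A).Nonempty := Finset.sdiff_nonempty.2 fun h' => hA2 (hA.antisymm h')
    rcases eq_singleton_or_two_le_card hB with ⟨v, hv⟩ | hc'
    -- The complement is a single vertex: it has the same cut, and the opposite residue because the
    -- total is $0$ modulo $2k$.
    · have h1 := hsing v (Finset.sdiff_subset (hv ▸ Finset.mem_singleton_self v))
      rw [← hv, cut_compl ends] at h1
      have h2 : cnorm k (∑ v ∈ A, τ v) = cnorm k (τ v) := by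
        rw [← Finset.sum_sdiff hA, hv, Finset.sum_singleton] at total
        rw [← cnorm_neg hk]
        exact cnorm_congr (dvd_of_eq_neg total (by ring))
      rwa [h2]
    · have h1 := hess A hAG (by rwa [Set.ncard_coe_finset])
        (by rwa [← hWG, ← Finset.coe_sdiff, Set.ncard_coe_finset])
      refine le_of_three_mul_le hk ?_ (parity A hA)
      rw [← cutSize_eq_cut hF hl]
      omega
  · have h1 := hc A hAG (Finset.coe_nonempty.2 hA1)
      fun h => hA2 (Finset.coe_injective (h.trans hWG.symm))
    refine le_of_three_mul_le hk ?_ (parity A hA)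
    rw [← cutSize_eq_cut hF hl]
    omega

theorem exists_boundedFactor {G : Graph α β} (hV : G.vertexSet.Finite) (hE : G.edgeSet.Finite)
    (hG : IsBipartite G) {k : ℕ} (hk : 0 < k) {f : α → ZMod k} (hf : IsCompatible G f)
    (hconn :
      (IsEssentiallyEdgeConnected G (3 * k - 3) ∧
        ∀ v ∈ G.vertexSet, 2 * (k : ℤ) - 1 + bracket (f v) ≤ (degree G v : ℤ)) ∨
      IsEdgeConnected G (3 * k - 3))
    {z : α} (hz : z ∈ G.vertexSet) {t : ℤ} (ht : (t : ZMod k) = f z) (htz : InInterval G k z t) :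
    ∃ H : Graph α β, IsBoundedFactor G f H ∧ (degree H z : ℤ) = t := by
  classical
  have : NeZero k := ⟨hk.ne'⟩
  obtain ⟨X, Y, hXY, hlink⟩ := hG
  obtain ⟨p, q, hpq⟩ : ∃ p q : β → α, ∀ e ∈ hE.toFinset,
      G.IsLink e (p e) (q e) ∧ p e ∈ X ∧ q e ∉ X := by
    have : Nonempty α := ⟨z⟩
    have hY : ∀ y ∈ Y, y ∉ X := fun y h1 h2 => Set.disjoint_left.1 hXY.1 h2 h1
    have key : ∀ e ∈ hE.toFinset, ∃ x y, G.IsLink e x y ∧ x ∈ X ∧ y ∉ X := fun e he => by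
      obtain ⟨x, y, h⟩ := G.exists_isLink_of_mem_edgeSet (hE.mem_toFinset.1 he)
      rcases hlink e x y h with ⟨h1, h2⟩ | ⟨h1, h2⟩
      · exact ⟨x, y, h, h1, hY y h2⟩
      · exact ⟨y, x, h.symm, h2, hY x h1⟩
    choose! p q h using key
    exact ⟨p, q, h⟩
  set F := hE.toFinset with hFdef
  set W := hV.toFinset with hWdef
  have hF : ∀ e, e ∈ F ↔ e ∈ G.edgeSet := fun e => hE.mem_toFinset
  have hW : ∀ v, v ∈ W ↔ v ∈ G.vertexSet := fun v => hV.mem_toFinset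
  have hne : ∀ e ∈ F, p e ≠ q e := fun e he h => (hpq e he).2.2 (h ▸ (hpq e he).2.1)
  have hl : ∀ e ∈ F, G.IsLink e (p e) (q e) := fun e he => (hpq e he).1
  have hside : ∀ e ∈ F, p e ∈ X ∧ q e ∉ X := fun e he => (hpq e he).2
  have ends : ∀ e ∈ F, p e ∈ W ∧ q e ∈ W := fun e he =>
    ⟨(hW _).2 (hl e he).left_mem, (hW _).2 (hl e he).right_mem⟩
  set τ : α → ℤ := fun v => side X v * (2 * (f v).val - degree G v) with hτ
  have hflow : ∀ v, flow F p q (fun _ => 1) {v} = side X v * degree G v := fun v => by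
    rw [flow_one hside, degree_eq_cut hF hl hne]
  have hτA : ∀ A, ∑ v ∈ A, τ v = 2 * ∑ v ∈ A, side X v * (f v).val - flow F p q (fun _ => 1) A := by
    intro A
    rw [flow_eq_sum, Finset.mul_sum, ← Finset.sum_sub_distrib]
    exact Finset.sum_congr rfl fun v _ => by rw [hflow, hτ]; ring
  have parity : ∀ A ⊆ W, (2 : ℤ) ∣ cut F p q A - ∑ v ∈ A, τ v := fun A _ => by
    have h1 := IsOrientation.two_dvd (σ := fun _ : β => 1) (F := F) (p := p) (q := q)
      (fun _ => .inl rfl) A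
    rw [hτA]
    omega
  have total : (2 * k : ℤ) ∣ ∑ v ∈ W, τ v := by
    have h1 : flow F p q (fun _ => 1) W = 0 := Finset.sum_eq_zero fun e he => by
      rw [ind_mem (ends e he).1, ind_mem (ends e he).2]; ring
    rw [hτA, h1, sub_zero]
    exact mul_dvd_mul_left 2 (dvd_sum_side_mul hk hXY hlink (hf X Y hXY) hW)
  have htf : (k : ℤ) ∣ t - (f z).val := by
    rw [← ZMod.intCast_zmod_eq_zero_iff_dvd]
    push_cast
    rw [ht]
    simp
  obtain ⟨σ, hσ, hs, hsz⟩ := exists_orientation hk ends parity total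
    (fun A h1 h2 h3 => le_cut hk hW hF hl hne (fun _ => rfl) parity total hconn h1 h2 h3)
    ((hW z).2 hz) (t := side X z * (2 * t - degree G z))
    ((dvd_mul_of_dvd_right (mul_dvd_mul_left 2 htf) (side X z)).trans
      (dvd_of_eq (by rw [hτ]; ring)))
    (by rw [abs_side_mul]; exact inInterval_iff.1 htz)
  -- Every edge has its end `p e` in $X$, so the edges with sign $1$ are those directed from $X$ to
  -- $Y$; they form the factor.
  have hH : ∀ e, e ∈ F.filter (fun e => σ e = 1) ↔
      e ∈ (G.restrict {e | σ e = 1}).edgeSet := fun e => by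
    simp [hF]
  have hdeg : ∀ v, flow F p q σ {v} =
      side X v * (2 * degree (G.restrict {e | σ e = 1}) v - degree G v) := fun v => by
    rw [flow_eq_two_mul_sub hσ, hflow, flow_one fun e he => hside e (Finset.mem_filter.1 he).1,
      degree_eq_cut hH (fun e he => ⟨(Finset.mem_filter.1 he).2, hl e (Finset.mem_filter.1 he).1⟩)
        fun e he => hne e (Finset.mem_filter.1 he).1]
    ring
  refine ⟨G.restrict {e | σ e = 1}, ⟨⟨Graph.restrict_le, rfl⟩, fun v hv => ?_⟩, ?_⟩
  · have h1 := hs v ((hW v).2 hv)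
    rw [hdeg, abs_side_mul] at h1
    refine ⟨?_, inInterval_iff.2 h1.2⟩
    have h2 : (2 * k : ℤ) ∣ 2 * (degree (G.restrict {e | σ e = 1}) v - (f v).val) := by
      have h3 := h1.1
      rw [hτ, ← mul_sub] at h3
      rcases side_cases X v with h | h <;> rw [h] at h3
      · exact h3.trans (dvd_of_eq (by ring))
      · exact dvd_of_eq_neg h3 (by ring)
    have h3 := (ZMod.intCast_zmod_eq_zero_iff_dvd _ k).2
      (Int.dvd_of_mul_dvd_mul_left two_ne_zero h2)
    push_cast at h3
    rw [sub_eq_zero] at h3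
    simpa using h3
  · rw [hdeg] at hsz
    rcases side_cases X z with h | h <;> rw [h] at hsz <;> omega

end Factor

end ModFactor

theorem mainTheorem1 {α β : Type*} (G : Graph α β)
    (hV : G.vertexSet.Finite) (hE : G.edgeSet.Finite)
    (hG : ModFactor.IsBipartite G)
    (k : ℕ) (hk : 0 < k) (f : α → ZMod k) (hf : ModFactor.IsCompatible G f)
    (hconn :
      (ModFactor.IsEssentiallyEdgeConnected G (3 * k - 3) ∧
        ∀ v ∈ G.vertexSet,
          2 * (k : ℤ) - 1 + ModFactor.bracket (f v) ≤ (ModFactor.degree G v : ℤ)) ∨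
      ModFactor.IsEdgeConnected G (3 * k - 3)) :
    (∃ H : Graph α β, ModFactor.IsBoundedFactor G f H) ∧
    (∀ z ∈ G.vertexSet, ∀ t : ℤ, (t : ZMod k) = f z → ModFactor.InInterval G k z t →
      ∃ H : Graph α β, ModFactor.IsBoundedFactor G f H ∧ (ModFactor.degree H z : ℤ) = t) := by
  classical
  refine ⟨?_, fun z hz t ht htz => ModFactor.exists_boundedFactor hV hE hG hk hf hconn hz ht htz⟩
  rcases G.vertexSet.eq_empty_or_nonempty with h0 | ⟨z, hz⟩
  · exact ⟨G, .rfl, fun v hv => absurd hv (by simp [h0])⟩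
  · obtain ⟨t, ht, htz⟩ := ModFactor.exists_mem_interval hk G z (f z)
    obtain ⟨H, hH, -⟩ := ModFactor.exists_boundedFactor hV hE hG hk hf hconn hz ht htz
    exact ⟨H, hH⟩
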